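/- Let $\mathbb F$ be a field of characteristic $0$ and let $\mathcal V$ be a unital commutative associative $\mathbb F$-algebra with an $\mathbb F$-linear derivation $\partial$. Write ${\textstyle\int}:\mathcal V\to\mathcal V/\partial\mathcal V$ for the quotient map, $\mathcal V((\partial^{-1}))$ for the algebra of pseudodifferential operators over $\mathcal V$, $A(z)$ for the symbol of $A(\partial)=\sum_{n\le N}a_n\partial^n$ (replace $\partial^n$ on the right by $z^n$), $A^*(\partial)=\sum_n(-\partial)^n\circ a_n$ for its formal adjoint, $A_+=\sum_{n\ge0}a_n\partial^n$ and $\operatorname{Res}_zA(z)=a_{-1}$; $(\cdot)_+$ is applied entrywise to matrices. Let $\{\cdot\,_\lambda\,\cdot\}:\mathcal V\times\mathcal V\to\mathcal V[\lambda]$ be a $\lambda$-bracket, i.e. an $\mathbb F$-bilinear map such that, for $a,b,c\in\mathcal V$, $$\{\partial a_\lambda b\}=-\lambda\{a_\lambda b\},\quad \{a_\lambda\partial b\}=(\lambda+\partial)\{a_\lambda b\},\quad \{a_\lambda bc\}=\{a_\lambda b\}c+\{a_\lambda c\}b,$$ $$\{ab_\lambda c\}=\{a_{\lambda+x}c\}\big(\big|_{x=\partial}b\big)+\{b_{\lambda+x}c\}\big(\big|_{x=\partial}a\big),$$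 where $p(\lambda+x)(|_{x=\partial}b)=\sum_np_n(\lambda+\partial)^nb$ for $p(\lambda)=\sum_np_n\lambda^n$. (Skewsymmetry and the Jacobi identity are not assumed.) Put $$\{{\textstyle\int}f,{\textstyle\int}g\}={\textstyle\int}\{f_\lambda g\}\big|_{\lambda=0}\in\mathcal V/\partial\mathcal V,\qquad \{{\textstyle\int}f,g\}=\{f_\lambda g\}\big|_{\lambda=0}\in\mathcal V ;$$ both are well defined. The Hamiltonian equation with Hamiltonian functional ${\textstyle\int}h$ is $\frac{du}{dt}=\{{\textstyle\int}h,u\}$, $u\in\mathcal V$; a functional ${\textstyle\int}g$ is an integral of motion of it if ${\textstyle\int}\frac{dg}{dt}=0$. Let $A(\partial)$ be an $N\times N$ matrix pseudodifferential operator over $\mathcal V$ that is invertible in $\operatorname{Mat}_{N\times N}\mathcal V((\partial^{-1}))$ and of Adler type, i.e. for all $i,j,h,k\in\{1,\dots,N\}$ $$\{A_{ij}(z)_\lambda A_{hk}(w)\}=A_{hj}(w+\lambda+\partial)\,\iota_z(z-w-\lambda-\partial)^{-1}(A_{ik})^*(\lambda-z)-A_{hj}(z)\,\iota_z(z-w-\lambda-\partial)^{-1}A_{ik}(w),$$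 where $\iota_z$ denotes the geometric series expansion for large $z$. For $K\in\mathbb Z\setminus\{0\}$ and a $K$-th root $B(\partial)\in\operatorname{Mat}_{N\times N}\mathcal V((\partial^{-1}))$ of $A$ (i.e. $A=B^K$; such a $B$ is invertible) let $$h_{n,B}=-\frac{K}{n}\operatorname{Res}_z\operatorname{tr}\big(B^n(z)\big)\ \text{ for } n\in\mathbb Z\setminus\{0\},\qquad h_{0,B}=0 .$$ Then, for all nonzero integers $K,L$, all $B,C$ with $A=B^K=C^L$, and all $m,n\in\mathbb Z$: (a) $\{{\textstyle\int}h_{m,B},{\textstyle\int}h_{n,C}\}=0$. (b) The Hamiltonian flow of ${\textstyle\int}h_{n,B}$ satisfies the Lax equation $$\frac{dA(z)}{dt_{n,B}}=\{{\textstyle\int}h_{n,B},A(z)\}=[(B^n)_+,A](z),$$ and every ${\textstyle\int}h_{n,C}$ is an integral of motion of the flow of every ${\textstyle\int}h_{m,B}$. Moreover the flows are compatible: on every differential subalgebra $\mathcal W\subseteq\mathcal V$ (for example $\mathcal W=\mathcal V$) that contains $h_{m,B}$ and $h_{n,C}$, is closed under the $\lambda$-bracket and is a Poisson vertex algebra with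 it (skewsymmetry and the Jacobi identity hold on $\mathcal W$), the flows of ${\textstyle\int}h_{m,B}$ and ${\textstyle\int}h_{n,C}$ commute. -/

import Mathlib

open scoped Polynomial

namespace AdlerType

noncomputable section

section PseudoDiff

variable {F V : Type*} [Field F] [CommRing V] [Algebra F V]

/-- A scalar pseudodifferential operator `∑ₙ aₙ ∂ⁿ` (`n ≤ N` for some integer `N`, the order being
unbounded below) over the differential algebra `(V, D)`; `coeff n` is `aₙ`. -/
@[ext]
structure PseudoDiffOp (D : Derivation F V V) where
  coeff : ℤ → V
  bounded : ∃ N : ℤ, ∀ n, N < n → coeff n = 0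

namespace PseudoDiffOp

variable {D : Derivation F V V}

theorem coeff_injective : Function.Injective (coeff : PseudoDiffOp D → ℤ → V) :=
  fun _ _ h => PseudoDiffOp.ext h

instance : Zero (PseudoDiffOp D) := ⟨⟨0, 0, fun _ _ => rfl⟩⟩

/-- The identity operator `1 = 1 ∂⁰`. -/
instance : One (PseudoDiffOp D) :=
  ⟨⟨fun n => if n = 0 then 1 else 0, 0, fun n hn => if_neg (by omega)⟩⟩

instance : Add (PseudoDiffOp D) :=
  ⟨fun a b => ⟨fun n => a.coeff n + b.coeff n, by
    obtain ⟨M, hM⟩ := a.bounded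
    obtain ⟨N, hN⟩ := b.bounded
    exact ⟨max M N, fun n hn => by rw [hM n (by omega), hN n (by omega), add_zero]⟩⟩⟩

instance : Neg (PseudoDiffOp D) :=
  ⟨fun a => ⟨fun n => -a.coeff n, by
    obtain ⟨M, hM⟩ := a.bounded
    exact ⟨M, fun n hn => by rw [hM n hn, neg_zero]⟩⟩⟩

instance : Sub (PseudoDiffOp D) :=
  ⟨fun a b => ⟨fun n => a.coeff n - b.coeff n, by
    obtain ⟨M, hM⟩ := a.bounded
    obtain ⟨N, hN⟩ := b.bounded
    exact ⟨max M N, fun n hn => by rw [hM n (by omega), hN n (by omega), sub_zero]⟩⟩⟩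

instance : SMul ℕ (PseudoDiffOp D) :=
  ⟨fun k a => ⟨fun n => k • a.coeff n, by
    obtain ⟨M, hM⟩ := a.bounded
    exact ⟨M, fun n hn => by rw [hM n hn, smul_zero]⟩⟩⟩

instance : SMul ℤ (PseudoDiffOp D) :=
  ⟨fun k a => ⟨fun n => k • a.coeff n, by
    obtain ⟨M, hM⟩ := a.bounded
    exact ⟨M, fun n hn => by rw [hM n hn, smul_zero]⟩⟩⟩

instance : AddCommGroup (PseudoDiffOp D) :=
  coeff_injective.addCommGroup coeff rfl (fun _ _ => rfl) (fun _ => rfl) (fun _ _ => rfl)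
    (fun _ _ => rfl) (fun _ _ => rfl)

@[simp] theorem coeff_zero (n : ℤ) : (0 : PseudoDiffOp D).coeff n = 0 := rfl

theorem coeff_one (n : ℤ) : (1 : PseudoDiffOp D).coeff n = if n = 0 then 1 else 0 := rfl

@[simp] theorem coeff_add (a b : PseudoDiffOp D) (n : ℤ) :
    (a + b).coeff n = a.coeff n + b.coeff n := rfl

/-- The `p = (i, k)` term of the coefficient of `∂ⁿ` in `a ∘ b`; it comes from
`∂ⁱ ∘ f = ∑ₖ (i choose k) (Dᵏ f) ∂ⁱ⁻ᵏ`. -/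
def mulTerm (a b : PseudoDiffOp D) (n : ℤ) (p : ℤ × ℕ) : V :=
  Ring.choose p.1 p.2 • (a.coeff p.1 * (D.toLinearMap ^ p.2) (b.coeff (n - p.1 + p.2)))

theorem mulTerm_finite (a b : PseudoDiffOp D) (n : ℤ) :
    (mulTerm a b n).HasFiniteSupport := by
  obtain ⟨M, hM⟩ := a.bounded
  obtain ⟨N, hN⟩ := b.bounded
  refine ((Set.finite_Icc (n - N) M).prod (Set.finite_Iic (M + N - n).toNat)).subset ?_
  rintro ⟨i, k⟩ h
  have h1 : i ≤ M := by
    by_contra hc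
    exact h (by simp [mulTerm, hM i (by omega)])
  have h2 : n - i + k ≤ N := by
    by_contra hc
    exact h (by simp [mulTerm, hN (n - i + k) (by omega)])
  simp only [Set.mem_prod, Set.mem_Icc, Set.mem_Iic]
  omega

/-- Composition of pseudodifferential operators (all sums are finite). -/
instance : Mul (PseudoDiffOp D) :=
  ⟨fun a b => ⟨fun n => ∑ᶠ p : ℤ × ℕ, Ring.choose p.1 p.2 •
      (a.coeff p.1 * (D.toLinearMap ^ p.2) (b.coeff (n - p.1 + p.2))), by
    obtain ⟨M, hM⟩ := a.bounded
    obtain ⟨N, hN⟩ := b.bounded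
    refine ⟨M + N, fun n hn => finsum_eq_zero_of_forall_eq_zero ?_⟩
    rintro ⟨i, k⟩
    by_cases hi : M < i
    · simp [hM i hi]
    · simp [hN (n - i + k) (by omega)]⟩⟩

theorem coeff_mul (a b : PseudoDiffOp D) (n : ℤ) :
    (a * b).coeff n = ∑ᶠ p : ℤ × ℕ, mulTerm a b n p := rfl

theorem iterate_leibniz (D : Derivation F V V) (s : ℕ) (b c : V) :
    (D.toLinearMap ^ s) (b * c) = ∑ p ∈ Finset.HasAntidiagonal.antidiagonal s,
      (s.choose p.1) • ((D.toLinearMap ^ p.1) b * (D.toLinearMap ^ p.2) c) := by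
  induction s with
  | zero => simp
  | succ s ih =>
    rw [Finset.sum_antidiagonal_choose_succ_nsmul
      (fun i j => (D.toLinearMap ^ i) b * (D.toLinearMap ^ j) c), pow_succ', Module.End.mul_apply,
      ih, map_sum, ← Finset.sum_add_distrib]
    refine Finset.sum_congr rfl fun p hp => ?_
    have hc : s.choose p.2 = s.choose p.1 := by
      rw [← Finset.HasAntidiagonal.mem_antidiagonal.1 hp, Nat.choose_symm_add]
    rw [hc, ← smul_add, map_nsmul]
    congr 1
    simp only [pow_succ', Module.End.mul_apply, Derivation.coeFn_coe, Derivation.leibniz, smul_eq_mul]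
    ring

/-- The identity on coefficients behind associativity of the composition. -/
theorem assoc_aux (i j : ℤ) (l : ℕ) (b c : V) :
    (∑ p ∈ Finset.HasAntidiagonal.antidiagonal l, (Ring.choose i p.1 * Ring.choose j p.2) •
      (D.toLinearMap ^ p.1) (b * (D.toLinearMap ^ p.2) c)) =
    ∑ p ∈ Finset.HasAntidiagonal.antidiagonal l, (Ring.choose i p.1 * Ring.choose (i + j - p.1) p.2) •
      ((D.toLinearMap ^ p.1) b * (D.toLinearMap ^ p.2) c) := by
  have key : ∀ k r : ℕ, Ring.choose i k * Ring.choose (i + j - k) r =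
      ∑ q ∈ Finset.HasAntidiagonal.antidiagonal r,
        ((k + q.1).choose k : ℤ) * Ring.choose i (k + q.1) * Ring.choose j q.2 := by
    intro k r
    rw [show i + j - k = (i - k) + j by ring, Ring.add_choose_eq r (Commute.all _ _),
      Finset.mul_sum]
    refine Finset.sum_congr rfl fun q _ => ?_
    have := Ring.choose_smul_choose i (Nat.le_add_right k q.1)
    rw [nsmul_eq_mul, Nat.add_sub_cancel_left] at this
    rw [this, mul_assoc]
  simp_rw [key, iterate_leibniz, Finset.smul_sum, Finset.sum_smul, Finset.sum_sigma']
  refine Finset.sum_nbij'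
    (fun x => ⟨(x.2.1, x.2.2 + x.1.2), (x.2.2, x.1.2)⟩)
    (fun x => ⟨(x.1.1 + x.2.1, x.2.2), (x.1.1, x.2.1)⟩) ?_ ?_ ?_ ?_ ?_
  · rintro ⟨⟨s, t⟩, k, u⟩ h
    simp only [Finset.mem_sigma, Finset.HasAntidiagonal.mem_antidiagonal] at h ⊢
    obtain ⟨h1, h2⟩ := h
    exact ⟨by omega, trivial⟩
  · rintro ⟨⟨s, t⟩, k, u⟩ h
    simp only [Finset.mem_sigma, Finset.HasAntidiagonal.mem_antidiagonal] at h ⊢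
    obtain ⟨h1, h2⟩ := h
    exact ⟨by omega, trivial⟩
  · rintro ⟨⟨s, t⟩, k, u⟩ h
    simp only [Finset.mem_sigma, Finset.HasAntidiagonal.mem_antidiagonal] at h
    obtain ⟨h1, rfl⟩ := h
    rfl
  · rintro ⟨⟨s, t⟩, k, u⟩ h
    simp only [Finset.mem_sigma, Finset.HasAntidiagonal.mem_antidiagonal] at h
    obtain ⟨h1, rfl⟩ := h
    rfl
  · rintro ⟨⟨s, t⟩, k, u⟩ h
    simp only [Finset.mem_sigma, Finset.HasAntidiagonal.mem_antidiagonal] at h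
    obtain ⟨h1, rfl⟩ := h
    simp only [pow_add, Module.End.mul_apply]
    rw [← natCast_zsmul, smul_smul]
    congr 1
    ring

/-- A finitely supported sum over `ℕ × ℕ` grouped along antidiagonals. -/
theorem finsum_antidiagonal {M : Type*} [AddCommMonoid M] (f : ℕ × ℕ → M) (L : ℕ)
    (hL : ∀ p, L ≤ p.1 + p.2 → f p = 0) :
    ∑ᶠ p, f p = ∑ l ∈ Finset.range L, ∑ p ∈ Finset.HasAntidiagonal.antidiagonal l, f p := by
  classical
  rw [← Finset.sum_biUnion]
  · refine finsum_eq_sum_of_support_subset _ fun p hp => ?_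
    simp only [Finset.coe_biUnion, Set.mem_iUnion, Finset.mem_coe, Finset.mem_range,
      Finset.HasAntidiagonal.mem_antidiagonal, exists_prop]
    refine ⟨_, ?_, rfl⟩
    by_contra hc
    exact hp (hL p (by omega))
  · intro x _ y _ hxy
    refine Finset.disjoint_left.2 fun p hp hq => hxy ?_
    rw [← Finset.HasAntidiagonal.mem_antidiagonal.1 hp, ← Finset.HasAntidiagonal.mem_antidiagonal.1 hq]

theorem mul_assoc_aux (a b c : PseudoDiffOp D) : a * b * c = a * (b * c) := by
  obtain ⟨Na, hNa⟩ := a.bounded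
  obtain ⟨Nb, hNb⟩ := b.bounded
  obtain ⟨Nc, hNc⟩ := c.bounded
  refine PseudoDiffOp.ext (funext fun n => ?_)
  let G : (ℤ × ℤ) × (ℕ × ℕ) → V := fun q =>
    (Ring.choose q.1.1 q.2.1 * Ring.choose (q.1.1 + q.1.2 - q.2.1) q.2.2) •
      (a.coeff q.1.1 * ((D.toLinearMap ^ q.2.1) (b.coeff q.1.2) *
        (D.toLinearMap ^ q.2.2) (c.coeff (n - q.1.1 - q.1.2 + (q.2.1 + q.2.2 : ℕ)))))
  let H : (ℤ × ℤ) × (ℕ × ℕ) → V := fun q =>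
    (Ring.choose q.1.1 q.2.1 * Ring.choose q.1.2 q.2.2) •
      (a.coeff q.1.1 * (D.toLinearMap ^ q.2.1) (b.coeff q.1.2 *
        (D.toLinearMap ^ q.2.2) (c.coeff (n - q.1.1 - q.1.2 + (q.2.1 + q.2.2 : ℕ)))))
  have hbox : ∀ f : (ℤ × ℤ) × (ℕ × ℕ) → V,
      (∀ i j k r, Na < i ∨ Nb < j ∨ Nc < n - i - j + (k + r : ℕ) → f ((i, j), (k, r)) = 0) →
      f.HasFiniteSupport := by
    intro f hf
    refine (((Set.finite_Icc (n - Nc - Nb) Na).prod (Set.finite_Icc (n - Nc - Na) Nb)).prod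
      ((Set.finite_Iic (Na + Nb + Nc - n).toNat).prod
        (Set.finite_Iic (Na + Nb + Nc - n).toNat))).subset ?_
    rintro ⟨⟨i, j⟩, k, r⟩ h
    have h' : ¬ (Na < i ∨ Nb < j ∨ Nc < n - i - j + (k + r : ℕ)) := fun hc => h (hf i j k r hc)
    simp only [Set.mem_prod, Set.mem_Icc, Set.mem_Iic]
    omega
  have hG : G.HasFiniteSupport := by
    refine hbox G ?_
    rintro i j k r (h | h | h)
    · simp [G, hNa i h]
    · simp [G, hNb j h]
    · simp only [G]
      rw [hNc _ h]
      simp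
  have hH : H.HasFiniteSupport := by
    refine hbox H ?_
    rintro i j k r (h | h | h)
    · simp [H, hNa i h]
    · simp [H, hNb j h]
    · simp only [H]
      rw [hNc _ h]
      simp
  have hGH : ∑ᶠ q, G q = ∑ᶠ q, H q := by
    rw [finsum_curry G hG, finsum_curry H hH]
    refine finsum_congr ?_
    rintro ⟨i, j⟩
    have hz : ∀ p : ℕ × ℕ, (Nc - (n - i - j) + 1).toNat ≤ p.1 + p.2 →
        c.coeff (n - i - j + (p.1 + p.2 : ℕ)) = 0 := fun p hp => hNc _ (by omega)
    rw [finsum_antidiagonal _ (Nc - (n - i - j) + 1).toNat (fun p hp => by simp only [G]; rw [hz p hp]; simp),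
      finsum_antidiagonal _ (Nc - (n - i - j) + 1).toNat (fun p hp => by simp only [H]; rw [hz p hp]; simp)]
    refine Finset.sum_congr rfl fun l _ => ?_
    have := congrArg (fun v => a.coeff i * v)
      (assoc_aux (D := D) i j l (b.coeff j) (c.coeff (n - i - j + l)))
    simp only [Finset.mul_sum, mul_smul_comm] at this
    refine Eq.trans ?_ (this.symm.trans ?_)
    · refine Finset.sum_congr rfl fun p hp => ?_
      simp only [G]
      rw [Finset.HasAntidiagonal.mem_antidiagonal.1 hp]
    · refine Finset.sum_congr rfl fun p hp => ?_
      simp only [H]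
      rw [Finset.HasAntidiagonal.mem_antidiagonal.1 hp]
  let e : (ℤ × ℕ) × (ℤ × ℕ) ≃ (ℤ × ℤ) × (ℕ × ℕ) :=
    { toFun := fun x => ((x.2.1, x.1.1 - x.2.1 + x.2.2), (x.2.2, x.1.2))
      invFun := fun q => ((q.1.1 + q.1.2 - q.2.1, q.2.2), (q.1.1, q.2.1))
      left_inv := by
        rintro ⟨⟨p, r⟩, i, k⟩
        have : i + (p - i + (k : ℤ)) - k = p := by ring
        simp [this]
      right_inv := by
        rintro ⟨⟨i, j⟩, k, r⟩
        have : i + j - (k : ℤ) - i + k = j := by ring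
        simp [this] }
  let e' : (ℤ × ℕ) × (ℤ × ℕ) ≃ (ℤ × ℤ) × (ℕ × ℕ) :=
    { toFun := fun x => ((x.1.1, x.2.1), (x.1.2, x.2.2))
      invFun := fun q => ((q.1.1, q.2.1), (q.1.2, q.2.2))
      left_inv := fun _ => rfl
      right_inv := fun _ => rfl }
  have hL : (a * b * c).coeff n = ∑ᶠ q, G q := by
    rw [← finsum_comp_equiv e, finsum_curry (fun x => G (e x)) (hG.comp_of_injective e.injective), coeff_mul]
    refine finsum_congr ?_
    rintro ⟨p, r⟩
    let φ : V →+ V := (DistribSMul.toAddMonoidHom V (Ring.choose p r)).comp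
      (AddMonoidHom.mulRight ((D.toLinearMap ^ r) (c.coeff (n - p + r))))
    change φ ((a * b).coeff p) = _
    rw [coeff_mul, φ.map_finsum (mulTerm_finite a b p)]
    refine finsum_congr ?_
    rintro ⟨i, k⟩
    have h1 : i + (p - i + (k : ℤ)) - k = p := by ring
    have h2 : n - i - (p - i + (k : ℤ)) + ((k + r : ℕ) : ℤ) = n - p + r := by push_cast; ring
    simp only [φ, G, e, mulTerm, Equiv.coe_fn_mk, h1, h2, AddMonoidHom.comp_apply,
      AddMonoidHom.coe_mulRight, DistribSMul.toAddMonoidHom_apply, smul_mul_assoc, smul_smul,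
      mul_assoc]
    rw [mul_comm (Ring.choose p r)]
  have hR : (a * (b * c)).coeff n = ∑ᶠ q, H q := by
    rw [← finsum_comp_equiv e', finsum_curry (fun x => H (e' x)) (hH.comp_of_injective e'.injective), coeff_mul]
    refine finsum_congr ?_
    rintro ⟨i, s⟩
    let φ : V →+ V := (DistribSMul.toAddMonoidHom V (Ring.choose i s)).comp
      ((AddMonoidHom.mulLeft (a.coeff i)).comp (D.toLinearMap ^ s).toAddMonoidHom)
    change φ ((b * c).coeff (n - i + s)) = _
    rw [coeff_mul, φ.map_finsum (mulTerm_finite b c _)]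
    refine finsum_congr ?_
    rintro ⟨j, t⟩
    have h2 : n - i + (s : ℤ) - j + t = n - i - j + ((s + t : ℕ) : ℤ) := by push_cast; ring
    simp only [φ, H, e', mulTerm, Equiv.coe_fn_mk, h2, AddMonoidHom.comp_apply,
      AddMonoidHom.coe_mulLeft, DistribSMul.toAddMonoidHom_apply, LinearMap.toAddMonoidHom_coe,
      map_zsmul, smul_smul]
    rw [mul_comm (Ring.choose j t)]
  rw [hL, hR, hGH]

instance : Ring (PseudoDiffOp D) where
  __ := (inferInstance : AddCommGroup (PseudoDiffOp D))
  left_distrib a b c := PseudoDiffOp.ext (funext fun n => by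
    rw [coeff_add, coeff_mul, coeff_mul, coeff_mul,
      ← finsum_add_distrib (mulTerm_finite a b n) (mulTerm_finite a c n)]
    exact finsum_congr fun p => by simp [mulTerm, mul_add])
  right_distrib a b c := PseudoDiffOp.ext (funext fun n => by
    rw [coeff_add, coeff_mul, coeff_mul, coeff_mul,
      ← finsum_add_distrib (mulTerm_finite a c n) (mulTerm_finite b c n)]
    exact finsum_congr fun p => by simp [mulTerm, add_mul])
  zero_mul a := PseudoDiffOp.ext (funext fun n => by
    rw [coeff_mul]
    exact finsum_eq_zero_of_forall_eq_zero fun p => by simp [mulTerm])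
  mul_zero a := PseudoDiffOp.ext (funext fun n => by
    rw [coeff_mul]
    exact finsum_eq_zero_of_forall_eq_zero fun p => by simp [mulTerm])
  mul_assoc := mul_assoc_aux
  one_mul a := PseudoDiffOp.ext (funext fun n => by
    rw [coeff_mul, finsum_eq_single _ ((0 : ℤ), 0)]
    · simp [mulTerm, coeff_one]
    · rintro ⟨i, k⟩ h
      rcases eq_or_ne i 0 with rfl | hi
      · rcases k with _ | k
        · exact absurd rfl h
        · simp [mulTerm, Ring.choose_zero_succ]
      · simp [mulTerm, coeff_one, hi])
  mul_one a := PseudoDiffOp.ext (funext fun n => by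
    rw [coeff_mul, finsum_eq_single _ (n, 0)]
    · simp [mulTerm, coeff_one]
    · rintro ⟨i, k⟩ h
      rcases k with _ | k
      · have : n - i ≠ 0 := fun hc => h (by simp; omega)
        simp [mulTerm, coeff_one, this]
      · rcases eq_or_ne (n - i + ((k + 1 : ℕ) : ℤ)) 0 with hz | hz
        · simp only [mulTerm, coeff_one, if_pos hz]
          simp [pow_succ]
        · simp only [mulTerm, coeff_one, if_neg hz]
          simp)
  zsmul := fun k a => k • a
  zsmul_zero' := fun a => zero_zsmul a
  zsmul_succ' := fun k a => SubNegMonoid.zsmul_succ' k a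
  zsmul_neg' := fun k a => SubNegMonoid.zsmul_neg' k a
  nsmul := fun k a => k • a
  nsmul_zero := fun a => zero_nsmul a
  nsmul_succ := fun k a => AddMonoid.nsmul_succ k a

/-- The part `∑_{n ≥ 0} aₙ ∂ⁿ` of nonnegative order. -/
def posPart (a : PseudoDiffOp D) : PseudoDiffOp D :=
  ⟨fun n => if 0 ≤ n then a.coeff n else 0, by
    obtain ⟨N, hN⟩ := a.bounded
    exact ⟨N, fun n hn => by rw [hN n hn, ite_self]⟩⟩

/-- The residue: the coefficient of `∂⁻¹`. -/
def residue (a : PseudoDiffOp D) : V := a.coeff (-1)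

/-- Application of a linear map to all coefficients. -/
def mapCoeff (φ : V →ₗ[F] V) (a : PseudoDiffOp D) : PseudoDiffOp D :=
  ⟨fun n => φ (a.coeff n), by
    obtain ⟨N, hN⟩ := a.bounded
    exact ⟨N, fun n hn => by rw [hN n hn, map_zero]⟩⟩

/-- The formal adjoint `a* = ∑ₙ (-∂)ⁿ ∘ aₙ`: the coefficient of `∂ʳ` collects the terms
`(-1)ⁿ (n choose k) Dᵏ aₙ` with `n - k = r`. -/
def adjoint (a : PseudoDiffOp D) : PseudoDiffOp D :=
  ⟨fun r => ∑ᶠ k : ℕ, (((r + k).negOnePow : ℤ) * Ring.choose (r + k) k) •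
      (D.toLinearMap ^ k) (a.coeff (r + k)), by
    obtain ⟨N, hN⟩ := a.bounded
    refine ⟨N, fun n hn => finsum_eq_zero_of_forall_eq_zero fun k => ?_⟩
    rw [hN (n + k) (by omega), map_zero, smul_zero]⟩

end PseudoDiffOp

/-- Integer powers in a ring; negative powers are meaningful for units only. -/
def intPow {R : Type*} [Ring R] (b : R) : ℤ → R
  | .ofNat k => b ^ k
  | .negSucc k => Ring.inverse b ^ (k + 1)

/-- `N × N` matrix pseudodifferential operators. -/
abbrev MatPseudoDiffOp (N : ℕ) (D : Derivation F V V) : Type _ :=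
  Matrix (Fin N) (Fin N) (PseudoDiffOp D)

/-- `B` is a `K`-th root of `A`, where `K` is a nonzero integer: `A = B ^ K`. -/
def IsRoot {N : ℕ} {D : Derivation F V V} (A : MatPseudoDiffOp N D) (K : ℤ)
    (B : MatPseudoDiffOp N D) : Prop :=
  K ≠ 0 ∧ (K < 0 → IsUnit B) ∧ intPow B K = A

/-- The density `h_{n,B} = (-K/n) Res tr Bⁿ` for `n ≠ 0`, and `h_{0,B} = 0`. -/
def hamDensity {N : ℕ} {D : Derivation F V V} (K : ℤ) (B : MatPseudoDiffOp N D) (n : ℤ) : V :=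
  if n = 0 then 0
  else (-(K : F) / (n : F)) • PseudoDiffOp.residue (Matrix.trace (intPow B n))

end PseudoDiff

section Bracket

variable {F V : Type*} [Field F] [CommRing V] [Algebra F V] (D : Derivation F V V)

/-- `D` applied to the coefficients of a polynomial in `λ`. -/
def polyD : V[X] →ₗ[F] V[X] :=
  Polynomial.lsum fun n => (Polynomial.monomial n).restrictScalars F ∘ₗ D.toLinearMap

theorem coeff_polyD (p : V[X]) (n : ℕ) : (polyD D p).coeff n = D (p.coeff n) := by
  induction p using Polynomial.induction_on' with
  | add p q hp hq => simp [hp, hq]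
  | monomial k a =>
    have : polyD D (Polynomial.monomial k a) = Polynomial.monomial k (D a) := by
      simp [polyD, Polynomial.lsum, Polynomial.sum_monomial_index]
    rw [this, Polynomial.coeff_monomial, Polynomial.coeff_monomial]
    split_ifs <;> simp

/-- The operator `λ + ∂` on `V[λ]` (the polynomial variable `X` is `λ`). -/
def lamD : V[X] →ₗ[F] V[X] :=
  LinearMap.mulLeft F (Polynomial.X : V[X]) + polyD D

/-- For `p(λ) = ∑ₙ pₙ λⁿ` and `b ∈ V`, the polynomial
`p(λ + x)(|_{x = ∂} b) = ∑ₙ pₙ (λ + ∂)ⁿ b`. -/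
def shiftInto (p : V[X]) (b : V) : V[X] :=
  p.sum fun n a => Polynomial.C a * (lamD D ^ n) (Polynomial.C b)

/-- A `λ`-bracket on the differential algebra `(V, D)`: an `F`-bilinear map
`V × V → V[λ]` satisfying sesquilinearity and the left and right Leibniz rules. -/
structure LambdaBracket where
  br : V →ₗ[F] V →ₗ[F] V[X]
  sesq_left : ∀ a b, br (D a) b = -(Polynomial.X * br a b)
  sesq_right : ∀ a b, br a (D b) = lamD D (br a b)
  leibniz_right : ∀ a b c,
    br a (b * c) = br a b * Polynomial.C c + br a c * Polynomial.C b
  leibniz_left : ∀ a b c,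
    br (a * b) c = shiftInto D (br a c) b + shiftInto D (br b c) a

/-- The space of local functionals `V / ∂V`. -/
abbrev Functionals : Type _ := V ⧸ LinearMap.range D.toLinearMap

/-- The quotient map `∫ : V → V / ∂V`. -/
def integral : V →ₗ[F] Functionals D := Submodule.mkQ _

theorem integral_D (a : V) : integral D (D a) = 0 :=
  (Submodule.Quotient.mk_eq_zero _).2 ⟨a, rfl⟩

namespace LambdaBracket

variable {D} (lb : LambdaBracket D)

/-- `{f_λ g}` at `λ = 0`. -/
def atZero : V →ₗ[F] V →ₗ[F] V :=
  lb.br.compr₂ ((Polynomial.lcoeff V 0).restrictScalars F)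

theorem atZero_apply (f g : V) : lb.atZero f g = (lb.br f g).coeff 0 := rfl

/-- The action `{∫f, g} = {f_λ g}|_{λ=0}` of local functionals on `V`. The Hamiltonian equation
with Hamiltonian functional `H` is `du/dt = {H, u}`, so `lb.flow H` is the time derivative
`d/dt` on `V` along this equation. -/
def flow : Functionals D →ₗ[F] V →ₗ[F] V :=
  Submodule.liftQ _ lb.atZero (by
    rintro _ ⟨a, rfl⟩
    refine LinearMap.mem_ker.2 (LinearMap.ext fun g => ?_)
    change (lb.br (D a) g).coeff 0 = 0
    rw [lb.sesq_left]
    simp)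

theorem flow_integral (f g : V) : lb.flow (integral D f) g = (lb.br f g).coeff 0 := rfl

/-- The bracket `{∫f, ∫g} = ∫ {f_λ g}|_{λ=0}` on local functionals. -/
def funBracket : Functionals D →ₗ[F] Functionals D →ₗ[F] Functionals D :=
  (Submodule.liftQ _ (lb.flow.compr₂ (integral D)).flip (by
    rintro _ ⟨g, rfl⟩
    refine LinearMap.mem_ker.2 (LinearMap.ext fun H => ?_)
    obtain ⟨f, rfl⟩ := Submodule.Quotient.mk_surjective _ H
    change integral D ((lb.br f (D g)).coeff 0) = 0
    rw [lb.sesq_right, lamD, LinearMap.add_apply, Polynomial.coeff_add, coeff_polyD]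
    simp [integral_D])).flip

theorem funBracket_integral (f g : V) :
    lb.funBracket (integral D f) (integral D g) = integral D ((lb.br f g).coeff 0) := rfl

/-- The functional `G` is an integral of motion of the Hamiltonian equation `du/dt = {H, u}`:
for every density `g` of `G` one has `∫ dg/dt = 0`. -/
def IsIntegralOfMotion (H G : Functionals D) : Prop :=
  ∀ g : V, integral D g = G → integral D (lb.flow H g) = 0

/-- The differential subalgebra `W` is closed under the `λ`-bracket, and is a Poisson vertex
algebra with it: skewsymmetry `{b_λ a} = -(|_{x=∂} {a_{-λ-x} b})` and the Jacobi identity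
`{a_λ {b_μ c}} - {b_μ {a_λ c}} = {{a_λ b}_{λ+μ} c}` hold on `W`. In the last identity both
sides are in `V[λ][μ]`, the outer variable being `μ`. -/
structure IsPVASubalgebra (W : Subalgebra F V) : Prop where
  D_mem : ∀ a ∈ W, D a ∈ W
  br_mem : ∀ a ∈ W, ∀ b ∈ W, ∀ n, (lb.br a b).coeff n ∈ W
  skew : ∀ a ∈ W, ∀ b ∈ W,
    lb.br b a = -((lb.br a b).sum fun n c => ((-lamD D) ^ n) (Polynomial.C c))
  jacobi : ∀ a ∈ W, ∀ b ∈ W, ∀ c ∈ W,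
    ((lb.br b c).sum fun j e => Polynomial.monomial j (lb.br a e)) -
      ((lb.br a c).sum fun i e =>
        Polynomial.C (Polynomial.X ^ i) * (lb.br b e).map Polynomial.C) =
    (lb.br a b).sum fun k e => Polynomial.C (Polynomial.X ^ k) *
      (lb.br e c).eval₂ (Polynomial.C.comp Polynomial.C)
        (Polynomial.C Polynomial.X + Polynomial.X : V[X][X])

end LambdaBracket

end Bracket

section Adler

variable {F V : Type*} [Field F] [CommRing V] [Algebra F V] {D : Derivation F V V}

/-! Series in `w` (respectively in `z`, `w`) with coefficients in `V[λ]` are given by their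
coefficients `f n` of `wⁿ` (respectively `g m n` of `zᵐ wⁿ`). -/

/-- `(w + λ + ∂)ʳ f(w)`, expanded in nonnegative powers of `λ + ∂`. -/
def shiftPow (D : Derivation F V V) (r : ℤ) (f : ℤ → V[X]) : ℤ → V[X] := fun n =>
  ∑ᶠ s : ℕ, Ring.choose r s • (lamD D ^ s) (f (n - r + s))

/-- `a(w + λ + ∂) f(w)` for the symbol `a(z) = ∑ a_q z^q` of a pseudodifferential operator. -/
def symbolShift (a : PseudoDiffOp D) (f : ℤ → V[X]) : ℤ → V[X] := fun n =>
  ∑ᶠ q : ℤ, Polynomial.C (a.coeff q) * shiftPow D q f n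

/-- `ι_z (z - w - λ - ∂)⁻¹ g(z, w) = ∑_{p ≥ 0} z^{-p-1} (w + λ + ∂)^p g(z, w)`. -/
def resolvent (D : Derivation F V V) (g : ℤ → ℤ → V[X]) : ℤ → ℤ → V[X] := fun m n =>
  ∑ᶠ p : ℕ, shiftPow D p (g (m + p + 1)) n

/-- `a(z) g(z, w)` for the symbol `a(z)` of a pseudodifferential operator. -/
def symbolMul (a : PseudoDiffOp D) (g : ℤ → ℤ → V[X]) : ℤ → ℤ → V[X] := fun m n =>
  ∑ᶠ q : ℤ, Polynomial.C (a.coeff q) * g (m - q) n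

/-- `a(λ - z)` for the symbol `a(z) = ∑ a_r z^r` of a pseudodifferential operator, with
`(λ - z)^r = (-1)^r ∑_t (r choose t) (-λ)^t z^{r-t}` expanded for large `z`; it is regarded as a
series in `z`, `w` which does not involve `w`. -/
def symbolReflect (a : PseudoDiffOp D) : ℤ → ℤ → V[X] := fun m n =>
  if n = 0 then
    ∑ᶠ t : ℕ, ((m.negOnePow : ℤ) * Ring.choose (m + t) t) •
      (Polynomial.C (a.coeff (m + t)) * Polynomial.X ^ t)
  else 0

/-- The symbol `a(w)`, regarded as a series in `z`, `w` which does not involve `z`. -/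
def symbolW (a : PseudoDiffOp D) : ℤ → ℤ → V[X] := fun m n =>
  if m = 0 then Polynomial.C (a.coeff n) else 0

/-- The matrix pseudodifferential operator `A` is of Adler type with respect to the `λ`-bracket:
`{A_{ij}(z)_λ A_{hk}(w)} = A_{hj}(w+λ+∂) ι_z(z-w-λ-∂)⁻¹ (A_{ik})*(λ-z)
  - A_{hj}(z) ι_z(z-w-λ-∂)⁻¹ A_{ik}(w)`
for all indices, that is, the coefficients of `zᵐ wⁿ` of both sides agree for all `m`, `n`. -/
def IsAdlerType (lb : LambdaBracket D) {ι κ : Type*} (A : Matrix ι κ (PseudoDiffOp D)) : Prop :=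
  ∀ (i h : ι) (j k : κ) (m n : ℤ),
    lb.br ((A i j).coeff m) ((A h k).coeff n) =
      symbolShift (A h j) (resolvent D (symbolReflect (A i k).adjoint) m) n -
        symbolMul (A h j) (resolvent D (symbolW (A i k))) m n

end Adler

end

end AdlerType

open AdlerType

namespace AdlerType

noncomputable section

/-! Everything rests on one chain rule for powers, `pairing_zpow`. If `δ` is a derivation commuting
with `∂` and `A = B^K`, then cyclicity of the trace `∫ Res tr` gives `K ∫ δ(Res tr Bⁿ) = n ∫ Res tr
(δA · B^{n-K})`, both sides being `nK` times `∫ Res tr (δB · B^{n-1})`. The rule is used for two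
different "derivations", so it is proved for any biadditive pairing `β(a, b)` that behaves like `∫ a
δ(b)` (`IsDerivationPairing`). Such a pairing is the same as a ring homomorphism `b ↦ b + ε β(·, b)`
into a square-zero extension of `V` compatible with the derivations, and evaluation at `1` is a
functional there that kills total derivatives.

The first pairing is `β(a, b) = {b_∂ c} a`, with `c` a coefficient of `A`. At `a = 1` it is the
action `{∫b, c}`. The chain rule reduces `{∫h_{n,B}, A}` to brackets of entries of `A`, which the
Adler identity supplies. With `G = B^{n-K}`, taking the residue in `z` of the two kernels yields `A
(GA)₊` and `(AG)₊ A` (`finsum_actOn_symbolShift_resolvent`, `finsum_actOn_symbolMul_resolvent`).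
Since `GA = AG = Bⁿ`, their difference is `-[(Bⁿ)₊, A]`, and the factor `-K/n` in the density turns
it into the Lax equation (`lax_equation`).

The second pairing is `β(a, b) = ∫ a δ(b)` with `δ` the flow of `∫h_{m,B}`. As `δA = [P, A]`, the
chain rule reduces `∫ δ(h_{n,C})` to `∫ Res tr ([P, A] C^{n-L})`. This vanishes because `C^{n-L}`
commutes with `A = C^L` (`integral_flow_hamDensity`). That is the involution, hence also the
conservation law. On a Poisson vertex subalgebra the Jacobi identity at `λ = μ = 0` identifies the
commutator of two flows with the flow of the bracket of their Hamiltonians, which is zero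
(`flow_jacobi`). -/

/-- Upper negation for generalized binomial coefficients. -/
theorem choose_sub_one_sub (i : ℤ) (k : ℕ) :
    Ring.choose ((k : ℤ) - 1 - i) k = (-1) ^ k * Ring.choose i k := by
  have h := Ring.choose_neg (i + 1 - k) k
  rw [show -(i + 1 - (k : ℤ)) = k - 1 - i by ring,
    show i + 1 - (k : ℤ) + k - 1 = i by ring] at h
  rw [h, Units.smul_def, smul_eq_mul, Int.coe_negOnePow_natCast]

theorem finsum_prod_comm {α β M : Type*} [AddCommMonoid M] (f : α × β → M)
    (hf : f.HasFiniteSupport) : ∑ᶠ a, ∑ᶠ b, f (a, b) = ∑ᶠ b, ∑ᶠ a, f (a, b) := by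
  have hg : (fun q : β × α => f (q.2, q.1)).HasFiniteSupport :=
    hf.comp_of_injective (g := fun q : β × α => (q.2, q.1))
      (fun x y h => by simp only [Prod.mk.injEq] at h; exact Prod.ext h.2 h.1)
  rw [← finsum_curry f hf, ← finsum_curry (fun q : β × α => f (q.2, q.1)) hg,
    ← finsum_comp_equiv (Equiv.prodComm β α)]
  rfl

/-! ### The residue as a trace, and change of the coefficient algebra. -/

namespace PseudoDiffOp

section Trace

variable {F V : Type*} [Field F] [CommRing V] [Algebra F V] {D : Derivation F V V}

/-- Integration by parts: `ρ` stands for any functional killing total derivatives, such as `∫` or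
evaluation at `1` on the square-zero extension. -/
theorem map_iterate_by_parts {E : Type*} [AddCommGroup E] (ρ : V →+ E) (hρ : ∀ a, ρ (D a) = 0)
    (k : ℕ) (a b : V) :
    ρ (a * (D.toLinearMap ^ k) b) = (-1 : ℤ) ^ k • ρ ((D.toLinearMap ^ k) a * b) := by
  induction k generalizing a with
  | zero => simp
  | succ k ih =>
    have h := hρ (a * (D.toLinearMap ^ k) b)
    rw [D.leibniz, smul_eq_mul, smul_eq_mul, map_add] at h
    rw [pow_succ', Module.End.mul_apply, Derivation.coeFn_coe, eq_neg_of_add_eq_zero_left h,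
      mul_comm _ (D a), ih, pow_succ' (-1 : ℤ), mul_smul, neg_one_smul,
      ← pow_succ', pow_succ, Module.End.mul_apply, Derivation.coeFn_coe]

/-- The residue is a trace modulo total derivatives. -/
theorem map_residue_mul_comm {E : Type*} [AddCommGroup E] (ρ : V →+ E) (hρ : ∀ a, ρ (D a) = 0)
    (P Q : PseudoDiffOp D) : ρ (P * Q).residue = ρ (Q * P).residue := by
  -- For fixed `k`, the involution `i ↦ -1 - i + k` matches the terms of `Res PQ` and `Res QP`.
  -- Integration by parts and upper negation each contribute a sign `(-1)^k`.
  let e : ℤ × ℕ ≃ ℤ × ℕ :=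
    { toFun := fun x => (-1 - x.1 + x.2, x.2)
      invFun := fun x => (-1 - x.1 + x.2, x.2)
      left_inv := fun x => Prod.ext (by simp only; ring) rfl
      right_inv := fun x => Prod.ext (by simp only; ring) rfl }
  rw [residue, residue, coeff_mul, coeff_mul, ρ.map_finsum (mulTerm_finite P Q _),
    ρ.map_finsum (mulTerm_finite Q P _), ← finsum_comp_equiv e]
  refine finsum_congr ?_
  rintro ⟨i, k⟩
  have h1 : (-1 : ℤ) - (-1 - i + k) + k = i := by ring
  simp only [mulTerm, e, Equiv.coe_fn_mk, h1, map_zsmul]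
  rw [map_iterate_by_parts ρ hρ k (Q.coeff i), show (-1 : ℤ) - i + k = k - 1 - i by ring,
    choose_sub_one_sub, smul_smul, mul_comm (P.coeff _), mul_comm ((-1 : ℤ) ^ k)]

end Trace

section Map

variable {F V W : Type*} [Field F] [CommRing V] [Algebra F V] [CommRing W] [Algebra F W]
  {D : Derivation F V V} {D' : Derivation F W W}

theorem map_iterate (f : V →+* W) (hf : ∀ a, f (D a) = D' (f a)) (k : ℕ) (a : V) :
    f ((D.toLinearMap ^ k) a) = (D'.toLinearMap ^ k) (f a) := by
  induction k generalizing a with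
  | zero => rfl
  | succ k ih =>
    rw [pow_succ, pow_succ, Module.End.mul_apply, Module.End.mul_apply, ih]
    congr 1
    exact hf a

/-- A homomorphism of differential algebras, applied to all coefficients. -/
def mapHom (f : V →+* W) (hf : ∀ a, f (D a) = D' (f a)) : PseudoDiffOp D →+* PseudoDiffOp D' where
  toFun a := ⟨fun n => f (a.coeff n), by
    obtain ⟨N, hN⟩ := a.bounded
    exact ⟨N, fun n hn => by rw [hN n hn, map_zero]⟩⟩
  map_zero' := PseudoDiffOp.ext (funext fun n => map_zero f)
  map_one' := PseudoDiffOp.ext (funext fun n => by simp [coeff_one, apply_ite f])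
  map_add' a b := PseudoDiffOp.ext (funext fun n => map_add f _ _)
  map_mul' a b := PseudoDiffOp.ext (funext fun n => by
    change f ((a * b).coeff n) = _
    rw [coeff_mul, coeff_mul, map_finsum f (mulTerm_finite a b n)]
    refine finsum_congr fun p => ?_
    simp only [mulTerm, map_zsmul, map_mul, map_iterate f hf])

@[simp] theorem coeff_mapHom (f : V →+* W) (hf : ∀ a, f (D a) = D' (f a)) (a : PseudoDiffOp D)
    (n : ℤ) : (mapHom f hf a).coeff n = f (a.coeff n) := rfl

/-- The coefficient of `∂ⁿ` as an additive map. -/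
def coeffHom (D : Derivation F V V) (n : ℤ) : PseudoDiffOp D →+ V where
  toFun a := a.coeff n
  map_zero' := rfl
  map_add' _ _ := rfl

@[simp] theorem coeffHom_apply (a : PseudoDiffOp D) (n : ℤ) : coeffHom D n a = a.coeff n := rfl

theorem coeff_sub (a b : PseudoDiffOp D) (n : ℤ) : (a - b).coeff n = a.coeff n - b.coeff n := rfl

theorem coeff_sum {ι : Type*} (s : Finset ι) (f : ι → PseudoDiffOp D) (n : ℤ) :
    (∑ i ∈ s, f i).coeff n = ∑ i ∈ s, (f i).coeff n := map_sum (coeffHom D n) f s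

end Map

section MatrixTrace

variable {F V E : Type*} [Field F] [CommRing V] [Algebra F V] [AddCommGroup E]
  {D : Derivation F V V} {N : ℕ}

/-- The composition of an additive map with the residue of the trace. -/
def residueTrace (ρ : V →+ E) : MatPseudoDiffOp N D →+ E :=
  ρ.comp ((coeffHom D (-1)).comp (Matrix.traceAddMonoidHom (Fin N) _))

theorem residueTrace_eq (ρ : V →+ E) (X : MatPseudoDiffOp N D) :
    residueTrace ρ X = ρ (Matrix.trace X).residue := rfl

theorem residueTrace_apply (ρ : V →+ E) (X : MatPseudoDiffOp N D) :
    residueTrace ρ X = ∑ i, ρ (X i i).residue := by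
  rw [residueTrace_eq, Matrix.trace, residue, coeff_sum, map_sum]
  rfl

theorem residueTrace_mul (ρ : V →+ E) (X Y : MatPseudoDiffOp N D) :
    residueTrace ρ (X * Y) = ∑ i, ∑ j, ρ (X i j * Y j i).residue := by
  rw [residueTrace_apply]
  refine Finset.sum_congr rfl fun i _ => ?_
  rw [Matrix.mul_apply, residue, coeff_sum, map_sum]
  rfl

theorem residueTrace_mul_comm (ρ : V →+ E) (hρ : ∀ a, ρ (D a) = 0) (X Y : MatPseudoDiffOp N D) :
    residueTrace ρ (X * Y) = residueTrace ρ (Y * X) := by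
  rw [residueTrace_mul, residueTrace_mul, Finset.sum_comm]
  exact Finset.sum_congr rfl fun i _ => Finset.sum_congr rfl fun j _ =>
    map_residue_mul_comm _ hρ _ _

end MatrixTrace

end PseudoDiffOp

/-! ### The chain rule for powers under a trace. -/

section AbstractChainRule

/-- The chain rule for powers of a unit under a trace: `ψ - ι` is a derivation along `ι`. -/
theorem trace_sub_zpow {R S E : Type*} [Ring R] [Ring S] [AddCommGroup E] (ψ ι : R →+* S)
    (h : ∀ x y, (ψ x - ι x) * (ψ y - ι y) = 0) (τ : S →+ E) (hτ : ∀ x y, τ (x * y) = τ (y * x))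
    (B : Rˣ) (n m : ℤ) :
    τ ((ψ ↑(B ^ n) - ι ↑(B ^ n)) * ι ↑(B ^ m)) =
      n • τ ((ψ B - ι B) * ι ↑(B ^ (n + m - 1))) := by
  have hstep : ∀ n m : ℤ, τ ((ψ ↑(B ^ (n + 1)) - ι ↑(B ^ (n + 1))) * ι ↑(B ^ m)) =
      τ ((ψ ↑(B ^ n) - ι ↑(B ^ n)) * ι ↑(B ^ (m + 1))) +
        τ ((ψ B - ι B) * ι ↑(B ^ (n + m))) := by
    intro n m
    have h1 : ψ ↑(B ^ (n + 1)) - ι ↑(B ^ (n + 1)) =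
        (ψ ↑(B ^ n) - ι ↑(B ^ n)) * ι B + ι ↑(B ^ n) * (ψ B - ι B) := by
      -- The Leibniz rule for `ψ - ι` fails only by the product of two differences, which is zero by
      -- hypothesis.
      have h0 := h ↑(B ^ n) B
      rw [zpow_add, zpow_one, Units.val_mul, map_mul, map_mul]
      rw [← sub_eq_zero, ← h0]
      noncomm_ring
    have h2 : (↑(B ^ (m + 1)) : R) = B * ↑(B ^ m) := by
      rw [add_comm m, zpow_add, zpow_one, Units.val_mul]
    rw [h1, add_mul, map_add, mul_assoc, ← map_mul, ← h2, mul_assoc, hτ (ι ↑(B ^ n)), mul_assoc,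
      ← map_mul, ← Units.val_mul, ← zpow_add, add_comm m n]
  induction n using Int.induction_on generalizing m with
  | zero => simp
  | succ i ih =>
    rw [hstep, ih, add_smul, one_smul, show (i : ℤ) + 1 + m - 1 = i + m by ring,
      show (i : ℤ) + (m + 1) - 1 = i + m by ring]
  | pred i ih =>
    -- The recursion is read backwards, so no separate formula for the variation of `B⁻¹` is needed.
    have h3 := hstep (-i - 1) (m - 1)
    rw [sub_add_cancel, sub_add_cancel, ih] at h3
    rw [show -(i : ℤ) + (m - 1) - 1 = -i - 1 + m - 1 by ring,
      show -(i : ℤ) - 1 + (m - 1) = -i - 1 + m - 1 by ring] at h3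
    rw [sub_smul, one_smul, h3, add_sub_cancel_right]

end AbstractChainRule

/-! ### The square-zero extension of `V` by its dual module. -/

section DualModule

variable {V E : Type*} [CommRing V] [AddCommGroup E]

/-- Additive maps `V → E` with `V` acting by precomposition with multiplication. -/
def DualModule (V E : Type*) [CommRing V] [AddCommGroup E] : Type _ := V →+ E

namespace DualModule

instance : AddCommGroup (DualModule V E) := inferInstanceAs (AddCommGroup (V →+ E))

/-- When `E = V`, plain additive maps also carry the pointwise action on values. The synonym keeps
that action apart from precomposition. -/
instance : Module V (DualModule V E) where
  smul a m := (show V →+ E from m).comp (AddMonoidHom.mulLeft a)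
  one_smul m := AddMonoidHom.ext fun x => congrArg (show V →+ E from m) (one_mul x)
  mul_smul a b m := AddMonoidHom.ext fun x => congrArg (show V →+ E from m)
    (by change a * b * x = b * (a * x); ring)
  smul_zero _ := rfl
  smul_add _ _ _ := rfl
  add_smul a b m := AddMonoidHom.ext fun x =>
    (congrArg (show V →+ E from m) (add_mul a b x)).trans (map_add (show V →+ E from m) _ _)
  zero_smul m := AddMonoidHom.ext fun x =>
    (congrArg (show V →+ E from m) (zero_mul x)).trans (map_zero (show V →+ E from m))

instance : Module Vᵐᵒᵖ (DualModule V E) := Module.compHom _ ((RingHom.id V).fromOpposite Commute.all)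

instance : IsCentralScalar V (DualModule V E) := ⟨fun _ _ => rfl⟩

/-- Evaluation of an element of the dual module. -/
def eval (x : V) : DualModule V E →+ E := AddMonoidHom.eval x

theorem eval_smul (x a : V) (m : DualModule V E) : eval x (a • m) = eval (a * x) m := rfl

theorem eval_add (x y : V) (m : DualModule V E) : eval (x + y) m = eval x m + eval y m :=
  map_add (show V →+ E from m) x y

/-- An additive map as an element of the dual module. -/
def ofHom : (V →+ E) →+ DualModule V E := AddMonoidHom.id _

theorem eval_ofHom (x : V) (m : V →+ E) : eval x (ofHom m) = m x := rfl

theorem ext_eval {m m' : DualModule V E} (h : ∀ x, eval x m = eval x m') : m = m' :=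
  AddMonoidHom.ext h

end DualModule

open TrivSqZeroExt

variable {F : Type*} [Field F] [Algebra F V]

/-- `E` is only an abelian group, so `F` acts on the infinitesimal part through its image in `V`. -/
instance dualAlgebra : Algebra F (TrivSqZeroExt V (DualModule V E)) :=
  ((inlHom V (DualModule V E)).comp (algebraMap F V)).toAlgebra

/-- The derivation `m ↦ -(m ∘ D)` of the dual module. -/
def dualD (D : Derivation F V V) : DualModule V E →+ DualModule V E where
  toFun m := -DualModule.ofHom ((show V →+ E from m).comp D.toLinearMap.toAddMonoidHom)
  map_zero' := neg_eq_zero.2 rfl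
  map_add' m m' := neg_add (DualModule.ofHom ((show V →+ E from m).comp D.toLinearMap.toAddMonoidHom))
    (DualModule.ofHom ((show V →+ E from m').comp D.toLinearMap.toAddMonoidHom))

theorem eval_dualD (D : Derivation F V V) (x : V) (m : DualModule V E) :
    DualModule.eval x (dualD D m) = -DualModule.eval (D x) m :=
  map_neg (DualModule.eval x) (DualModule.ofHom _)

/-- The sign in `dualD` is what makes this work: `-m(a·Dx) = -m(D(ax)) + m(Da·x)`. -/
theorem dualD_smul (D : Derivation F V V) (a : V) (m : DualModule V E) :
    dualD D (a • m) = a • dualD D m + D a • m := by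
  refine DualModule.ext_eval fun x => ?_
  simp only [eval_dualD, DualModule.eval_smul, map_add, D.leibniz, smul_eq_mul, DualModule.eval_add]
  rw [mul_comm x]
  abel

/-- The derivation of the square-zero extension of `V` by its dual module. -/
def dualDerivation (E : Type*) [AddCommGroup E] (D : Derivation F V V) :
    Derivation F (TrivSqZeroExt V (DualModule V E)) (TrivSqZeroExt V (DualModule V E)) :=
  Derivation.mk'
    { toFun := fun x => inl (D x.fst) + inr (dualD D x.snd)
      map_add' := fun x y => by ext <;> simp
      map_smul' := fun c x => by
        have : ∀ y : TrivSqZeroExt V (DualModule V E), c • y = inl (algebraMap F V c) * y :=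
          fun y => Algebra.smul_def c y
        simp only [this, RingHom.id_apply]
        ext
        · simp
        · simp [dualD_smul] }
    (fun x y => by
      ext
      · simp
      · simp [dualD_smul]
        abel)

theorem dualDerivation_apply (D : Derivation F V V) (x : TrivSqZeroExt V (DualModule V E)) :
    dualDerivation E D x = inl (D x.fst) + inr (dualD D x.snd) := rfl

theorem dualDerivation_inl (D : Derivation F V V) (a : V) :
    dualDerivation E D (inl a) = inl (D a) := by
  simp [dualDerivation_apply]

end DualModule

/-! ### Derivation pairings as ring homomorphisms, and the chain rule for pseudodifferential
operators. -/

section Pairing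

open TrivSqZeroExt PseudoDiffOp

variable {F V E : Type*} [Field F] [CommRing V] [Algebra F V] [AddCommGroup E]
  {D : Derivation F V V}

/-- `β` is a derivation in its second argument, with the first one as a module of coefficients:
this is how `(a, b) ↦ ∫ a δ(b)` behaves for a derivation `δ` commuting with `D`. -/
structure IsDerivationPairing (D : Derivation F V V) (β : V →+ V →+ E) : Prop where
  mul : ∀ a b c, β a (b * c) = β (a * b) c + β (a * c) b
  deriv : ∀ a b, β a (D b) = -β (D a) b

/-- The pairing induced by `β` of pseudodifferential operators: `∫ Res (δX G)`. -/
def pairing (β : V →+ V →+ E) (X G : PseudoDiffOp D) : E :=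
  ∑ᶠ p : ℤ × ℕ, Ring.choose p.1 p.2 •
    β ((D.toLinearMap ^ p.2) (G.coeff (-1 - p.1 + p.2))) (X.coeff p.1)

namespace IsDerivationPairing

variable {β : V →+ V →+ E} (hβ : IsDerivationPairing D β)

include hβ in
/-- The homomorphism `b ↦ b + ε β(·, b)`. -/
def dualHom : V →+* TrivSqZeroExt V (DualModule V E) where
  toFun b := inl b + inr (DualModule.ofHom (β.flip b))
  map_zero' := by rw [map_zero, map_zero, inl_zero, inr_zero, add_zero]
  map_one' := by
    have h : DualModule.ofHom (β.flip 1) = 0 := DualModule.ext_eval fun x => by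
      have := hβ.mul x 1 1
      rw [mul_one, mul_one] at this
      rw [DualModule.eval_ofHom, map_zero]
      exact left_eq_add.1 this
    rw [h, inr_zero, add_zero, inl_one]
  map_add' b c := by
    rw [map_add, map_add, inl_add, inr_add]
    abel
  map_mul' b c := by
    have h : DualModule.ofHom (β.flip (b * c)) =
        b • DualModule.ofHom (β.flip c) + c • DualModule.ofHom (β.flip b) :=
      DualModule.ext_eval fun x => by
        rw [map_add, DualModule.eval_smul, DualModule.eval_smul]
        simp only [DualModule.eval_ofHom, AddMonoidHom.flip_apply]
        rw [hβ.mul, mul_comm x, mul_comm x]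
    rw [h]
    ext
    · simp [-inr_add, fst_add, fst_mul]
    · simp [-inr_add, snd_add, snd_mul]

theorem dualHom_apply (b : V) : hβ.dualHom b = inl b + inr (DualModule.ofHom (β.flip b)) := rfl

theorem dualHom_D (b : V) : hβ.dualHom (D b) = dualDerivation E D (hβ.dualHom b) := by
  have h : DualModule.ofHom (β.flip (D b)) = dualD D (DualModule.ofHom (β.flip b)) :=
    DualModule.ext_eval fun x => by
      rw [eval_dualD, DualModule.eval_ofHom, DualModule.eval_ofHom]
      exact hβ.deriv x b
  rw [dualDerivation_apply, dualHom_apply, dualHom_apply, h]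
  simp [-inr_add]

/-- The infinitesimal ideal is stable under the derivation and has square zero, so operators with
coefficients in it multiply to zero. This gives the hypothesis of `trace_sub_zpow`. -/
theorem mul_eq_zero_of_fst_eq_zero (x y : PseudoDiffOp (dualDerivation E D))
    (hx : ∀ n, (x.coeff n).fst = 0) (hy : ∀ n, (y.coeff n).fst = 0) : x * y = 0 := by
  refine PseudoDiffOp.ext (funext fun n => ?_)
  rw [coeff_mul]
  refine finsum_eq_zero_of_forall_eq_zero fun p => ?_
  have h : ∀ (k : ℕ) (a : TrivSqZeroExt V (DualModule V E)), a.fst = 0 →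
      (((dualDerivation E D).toLinearMap ^ k) a).fst = 0 := by
    intro k a ha
    induction k with
    | zero => exact ha
    | succ k ih =>
      rw [pow_succ', Module.End.mul_apply, Derivation.coeFn_coe, dualDerivation_apply, fst_add,
        ih]
      simp
  have h2 : ∀ a b : TrivSqZeroExt V (DualModule V E), a.fst = 0 → b.fst = 0 → a * b = 0 := by
    intro a b ha hb
    ext
    · simp [ha]
    · simp [ha, hb]
  rw [mulTerm, h2 _ _ (hx _) (h _ _ (hy _)), smul_zero]

/-- The homomorphism of algebras of pseudodifferential operators induced by `dualHom`. -/
def opHom : PseudoDiffOp D →+* PseudoDiffOp (dualDerivation E D) :=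
  mapHom hβ.dualHom hβ.dualHom_D

variable (E D) in
/-- The inclusion of algebras of pseudodifferential operators. -/
def opIncl : PseudoDiffOp D →+* PseudoDiffOp (dualDerivation E D) :=
  mapHom (inlHom V (DualModule V E)) (fun a => (dualDerivation_inl D a).symm)

theorem coeff_opHom_sub (X : PseudoDiffOp D) (n : ℤ) :
    (hβ.opHom X - opIncl E D X).coeff n = inr (DualModule.ofHom (β.flip (X.coeff n))) := by
  change hβ.dualHom (X.coeff n) - inl (X.coeff n) = _
  rw [dualHom_apply, add_sub_cancel_left]

variable (V E) in
/-- Evaluation of the infinitesimal part at `1`. -/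
def evalOne : TrivSqZeroExt V (DualModule V E) →+ E where
  toFun x := DualModule.eval 1 x.snd
  map_zero' := by rw [snd_zero, map_zero]
  map_add' x y := by rw [snd_add, map_add]

/-- Because `D 1 = 0`, evaluation at `1` kills total derivatives, so residues become cyclic after
it. No quotient of `E` is taken, which allows `E = V` for the bracket. -/
theorem evalOne_D (x : TrivSqZeroExt V (DualModule V E)) :
    evalOne V E (dualDerivation E D x) = 0 := by
  change DualModule.eval 1 (dualDerivation E D x).snd = 0
  rw [dualDerivation_apply, snd_add, snd_inl, zero_add, snd_inr, eval_dualD, D.map_one_eq_zero]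
  exact neg_eq_zero.2 (map_zero (show V →+ E from x.snd))

/-- This explains the formula for `pairing`: it is the residue of `δX · G`, computed in the
extension and evaluated at `1`. -/
theorem evalOne_residue (X G : PseudoDiffOp D) :
    evalOne V E ((hβ.opHom X - opIncl E D X) * opIncl E D G).residue = pairing β X G := by
  rw [residue, coeff_mul, (evalOne V E).map_finsum (mulTerm_finite _ _ _), pairing]
  refine finsum_congr fun p => ?_
  have h : (opIncl E D G).coeff (-1 - p.1 + p.2) = inlHom V (DualModule V E) (G.coeff (-1 - p.1 + p.2)) := rfl
  rw [mulTerm, coeff_opHom_sub, h,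
    ← map_iterate (inlHom V (DualModule V E)) (fun a => (dualDerivation_inl D a).symm), map_zsmul]
  congr 1
  change DualModule.eval 1 (inr _ * inl _ : TrivSqZeroExt V (DualModule V E)).snd = _
  rw [inr_mul_inl, snd_inr, op_smul_eq_smul, DualModule.eval_smul, DualModule.eval_ofHom, mul_one]
  rfl

end IsDerivationPairing

/-- The chain rule for powers of an invertible matrix pseudodifferential operator. -/
theorem pairing_zpow {N : ℕ} {β : V →+ V →+ E} (hβ : IsDerivationPairing D β)
    (B : (MatPseudoDiffOp N D)ˣ) (K n : ℤ) :
    K • β 1 (Matrix.trace (↑(B ^ n) : MatPseudoDiffOp N D)).residue =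
      n • ∑ i, ∑ j, pairing β ((↑(B ^ K) : MatPseudoDiffOp N D) i j)
        ((↑(B ^ (n - K)) : MatPseudoDiffOp N D) j i) := by
  let ψ : MatPseudoDiffOp N D →+* MatPseudoDiffOp N (dualDerivation E D) := hβ.opHom.mapMatrix
  let ι : MatPseudoDiffOp N D →+* MatPseudoDiffOp N (dualDerivation E D) :=
    (IsDerivationPairing.opIncl E D).mapMatrix
  let τ : MatPseudoDiffOp N (dualDerivation E D) →+ E :=
    residueTrace (IsDerivationPairing.evalOne V E)
  have hsq : ∀ x y, (ψ x - ι x) * (ψ y - ι y) = 0 := by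
    intro x y
    refine Matrix.ext fun i j => ?_
    rw [Matrix.mul_apply, Matrix.zero_apply]
    refine Finset.sum_eq_zero fun k _ => ?_
    refine IsDerivationPairing.mul_eq_zero_of_fst_eq_zero _ _ (fun n => ?_) (fun n => ?_)
    · exact (congrArg fst (hβ.coeff_opHom_sub (x i k) n)).trans (fst_inr _ _)
    · exact (congrArg fst (hβ.coeff_opHom_sub (y k j) n)).trans (fst_inr _ _)
  have hτ : ∀ x y, τ (x * y) = τ (y * x) :=
    residueTrace_mul_comm _ IsDerivationPairing.evalOne_D
  -- Both instances end in the trace of `δB · B^{n-1}`, with factors `n` and `K`. Eliminating it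
  -- compares `δ(Bⁿ)` with `δ(B^K)`.
  have h1 := trace_sub_zpow ψ ι hsq τ hτ B n 0
  have h2 := trace_sub_zpow ψ ι hsq τ hτ B K (n - K)
  rw [add_zero, zpow_zero, Units.val_one, map_one, mul_one] at h1
  rw [add_sub_cancel] at h2
  have h3 : τ (ψ ↑(B ^ n) - ι ↑(B ^ n)) =
      β 1 (Matrix.trace (↑(B ^ n) : MatPseudoDiffOp N D)).residue := by
    rw [Matrix.trace, residue, coeff_sum, map_sum, residueTrace_apply]
    refine Finset.sum_congr rfl fun i _ => ?_
    refine Eq.trans (congrArg (fun y => IsDerivationPairing.evalOne V E y)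
      (hβ.coeff_opHom_sub _ _)) ?_
    rfl
  rw [← h3, h1, smul_smul, mul_comm, ← smul_smul, ← h2, residueTrace_mul]
  congr 1
  exact Finset.sum_congr rfl fun i _ => Finset.sum_congr rfl fun j _ => hβ.evalOne_residue _ _

end Pairing

/-! ### Finiteness and regrouping of sums; since `∑ᶠ` is `0` on infinite supports, each interchange
below is backed by a box coming from the orders of the operators. -/

section Finsum

variable {M : Type*} [AddCommMonoid M]

theorem hasFiniteSupport_of_forall {α : Type*} {f : α → M} {s : Set α} (hs : s.Finite)
    (h : ∀ a, f a ≠ 0 → a ∈ s) : f.HasFiniteSupport :=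
  hs.subset fun a ha => h a ha

theorem finite_box (a b : ℤ) (c : ℤ) : ((Set.Icc a b ×ˢ Set.Iic c.toNat : Set (ℤ × ℕ))).Finite :=
  (Set.finite_Icc a b).prod (Set.finite_Iic _)

theorem hasFiniteSupport_finsum {α β : Type*} {f : α × β → M} (hf : f.HasFiniteSupport) :
    (fun a => ∑ᶠ b, f (a, b)).HasFiniteSupport := by
  refine (hf.image Prod.fst).subset fun a ha => ?_
  obtain ⟨b, hb⟩ : ∃ b, f (a, b) ≠ 0 := by
    by_contra! hc
    exact ha (finsum_eq_zero_of_forall_eq_zero hc)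
  exact ⟨(a, b), hb, rfl⟩

theorem hasFiniteSupport_section {α β : Type*} {f : α × β → M} (hf : f.HasFiniteSupport) (a : α) :
    (fun b => f (a, b)).HasFiniteSupport :=
  hf.comp_of_injective (g := fun b => (a, b)) (Prod.mk_right_injective a)

theorem finsum_eq_finsum_antidiagonal (f : ℕ × ℕ → M) (hf : f.HasFiniteSupport) :
    ∑ᶠ p, f p = ∑ᶠ l, ∑ p ∈ Finset.HasAntidiagonal.antidiagonal l, f p := by
  obtain ⟨L, hL⟩ : ∃ L, ∀ p, L ≤ p.1 + p.2 → f p = 0 := by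
    obtain ⟨B, hB⟩ := (hf.image fun p => p.1 + p.2).bddAbove
    refine ⟨B + 1, fun p hp => ?_⟩
    by_contra hc
    have := hB ⟨p, hc, rfl⟩
    simp only at this
    omega
  rw [PseudoDiffOp.finsum_antidiagonal f L hL]
  refine (finsum_eq_sum_of_support_subset _ fun l hl => ?_).symm
  rw [Finset.mem_coe, Finset.mem_range]
  by_contra hc
  refine hl (Finset.sum_eq_zero fun p hp => hL p ?_)
  rw [Finset.HasAntidiagonal.mem_antidiagonal.1 hp]
  omega

end Finsum

/-! ### Substituting `λ = ∂` in polynomials, and the bracket as a derivation pairing. -/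

section Polynomial

variable {F V : Type*} [Field F] [CommRing V] [Algebra F V] {D : Derivation F V V}

theorem polyD_C_mul_X_pow (b : V) (t : ℕ) :
    polyD D (Polynomial.C b * Polynomial.X ^ t) = Polynomial.C (D b) * Polynomial.X ^ t := by
  ext n
  rw [coeff_polyD, Polynomial.coeff_C_mul_X_pow, Polynomial.coeff_C_mul_X_pow]
  split_ifs <;> simp

theorem lamD_pow_C (l : ℕ) (b : V) :
    (lamD D ^ l) (Polynomial.C b) = ∑ p ∈ Finset.HasAntidiagonal.antidiagonal l,
      l.choose p.1 • (Polynomial.C ((D.toLinearMap ^ p.2) b) * Polynomial.X ^ p.1) := by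
  induction l with
  | zero => simp
  | succ l ih =>
    rw [Finset.sum_antidiagonal_choose_succ_nsmul
      (fun i j => Polynomial.C ((D.toLinearMap ^ j) b) * (Polynomial.X : V[X]) ^ i), pow_succ',
      Module.End.mul_apply, ih, map_sum, ← Finset.sum_add_distrib]
    refine Finset.sum_congr rfl fun p hp => ?_
    have hc : l.choose p.2 = l.choose p.1 := by
      rw [← Finset.HasAntidiagonal.mem_antidiagonal.1 hp, Nat.choose_symm_add]
    rw [hc, ← smul_add, map_nsmul, lamD, LinearMap.add_apply, LinearMap.mulLeft_apply,
      polyD_C_mul_X_pow]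
    congr 1
    rw [pow_succ' D.toLinearMap, Module.End.mul_apply, Derivation.coeFn_coe]
    ring

variable (D) in
/-- `p(∂) a` for a polynomial `p(λ)` with coefficients in `V`. -/
def actOn (a : V) : V[X] →ₗ[V] V :=
  Polynomial.lsum fun l => LinearMap.mulRight V ((D.toLinearMap ^ l) a)

theorem actOn_monomial (a x : V) (n : ℕ) :
    actOn D a (Polynomial.monomial n x) = x * (D.toLinearMap ^ n) a := by
  simp [actOn, Polynomial.lsum, Polynomial.sum_monomial_index]

theorem actOn_C (a x : V) : actOn D a (Polynomial.C x) = x * a := by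
  rw [← Polynomial.monomial_zero_left, actOn_monomial, pow_zero, Module.End.one_apply]

theorem actOn_C_mul (a x : V) (p : V[X]) :
    actOn D a (Polynomial.C x * p) = x * actOn D a p := by
  rw [Polynomial.C_mul', map_smul, smul_eq_mul]

theorem actOn_X_mul (a : V) (p : V[X]) : actOn D a (Polynomial.X * p) = actOn D (D a) p := by
  induction p using Polynomial.induction_on' with
  | add p q hp hq => rw [mul_add, map_add, map_add, hp, hq]
  | monomial n x =>
    rw [Polynomial.X_mul_monomial, actOn_monomial, actOn_monomial, pow_succ]
    rfl

/-- In `p(∂) a`, the variable `λ` differentiates `a` and `∂` differentiates the coefficients, so `λ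
+ ∂` is the derivative of the product. Every `λ + ∂` in the Adler identity thus becomes `D`. -/
theorem actOn_lamD (a : V) (p : V[X]) : actOn D a (lamD D p) = D (actOn D a p) := by
  induction p using Polynomial.induction_on' with
  | add p q hp hq => simp only [map_add, hp, hq]
  | monomial n x =>
    rw [lamD, LinearMap.add_apply, LinearMap.mulLeft_apply, Polynomial.X_mul_monomial, map_add,
      ← Polynomial.C_mul_X_pow_eq_monomial (n := n), polyD_C_mul_X_pow,
      Polynomial.C_mul_X_pow_eq_monomial, Polynomial.C_mul_X_pow_eq_monomial, actOn_monomial,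
      actOn_monomial, actOn_monomial, D.leibniz, pow_succ', Module.End.mul_apply, smul_eq_mul,
      smul_eq_mul, mul_comm _ (D x)]
    rfl

theorem actOn_lamD_pow (a : V) (k : ℕ) (p : V[X]) :
    actOn D a ((lamD D ^ k) p) = (D.toLinearMap ^ k) (actOn D a p) := by
  induction k with
  | zero => rfl
  | succ k ih =>
    rw [pow_succ', pow_succ', Module.End.mul_apply, Module.End.mul_apply, actOn_lamD, ih]
    rfl

theorem actOn_add (a b : V) (p : V[X]) : actOn D (a + b) p = actOn D a p + actOn D b p := by
  induction p using Polynomial.induction_on' with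
  | add p q hp hq => rw [map_add, map_add, map_add, hp, hq]; abel
  | monomial n x => rw [actOn_monomial, actOn_monomial, actOn_monomial, map_add, mul_add]

theorem actOn_zero (p : V[X]) : actOn D 0 p = 0 := by
  have := actOn_add (D := D) 0 0 p
  rwa [add_zero, left_eq_add] at this

/-- Since `D 1 = 0`, acting on `1` amounts to setting `λ = 0`. This recovers the Hamiltonian flow
from the pairing. -/
theorem actOn_one (p : V[X]) : actOn D 1 p = p.coeff 0 := by
  induction p using Polynomial.induction_on' with
  | add p q hp hq => rw [map_add, hp, hq, Polynomial.coeff_add]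
  | monomial n x =>
    rw [actOn_monomial, Polynomial.coeff_monomial]
    rcases n with _ | n
    · simp
    · rw [pow_succ, Module.End.mul_apply, Derivation.coeFn_coe, D.map_one_eq_zero]
      simp

theorem actOn_shiftInto (a b : V) (p : V[X]) :
    actOn D a (shiftInto D p b) = actOn D (a * b) p := by
  induction p using Polynomial.induction_on' with
  | add p q hp hq =>
    have : shiftInto D (p + q) b = shiftInto D p b + shiftInto D q b :=
      Polynomial.sum_add_index p q _ (by simp) (fun n x y => by rw [map_add, add_mul])
    rw [this, map_add, map_add, hp, hq]
  | monomial n x =>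
    rw [shiftInto, Polynomial.sum_monomial_index _ _ (by simp), actOn_C_mul, actOn_lamD_pow,
      actOn_C, actOn_monomial, mul_comm a]

/-- The pairing `(a, b) ↦ {b_∂ c} a`. -/
def bracketPairing (lb : LambdaBracket D) (c : V) : V →+ V →+ V where
  toFun a := (actOn D a).toAddMonoidHom.comp (lb.br.flip c).toAddMonoidHom
  map_zero' := AddMonoidHom.ext fun _ => actOn_zero _
  map_add' a a' := AddMonoidHom.ext fun _ => actOn_add a a' _

theorem bracketPairing_apply (lb : LambdaBracket D) (c a b : V) :
    bracketPairing lb c a b = actOn D a (lb.br b c) := rfl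

/-- The left Leibniz rule and left sesquilinearity of the bracket are exactly the two axioms, once
`λ = ∂` is substituted. -/
theorem isDerivationPairing_bracket (lb : LambdaBracket D) (c : V) :
    IsDerivationPairing D (bracketPairing lb c) where
  mul a b b' := by
    simp only [bracketPairing_apply]
    rw [lb.leibniz_left, map_add, actOn_shiftInto, actOn_shiftInto, add_comm]
  deriv a b := by
    simp only [bracketPairing_apply]
    rw [lb.sesq_left, map_neg, actOn_X_mul]

end Polynomial

/-! ### The first Adler kernel. -/

open PseudoDiffOp

variable {F V : Type*} [Field F] [CommRing V] [Algebra F V] {D : Derivation F V V}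

theorem choose_mul_choose_sub (r : ℤ) (v s : ℕ) :
    Ring.choose r v * Ring.choose (r - v) s = ((v + s).choose v : ℤ) * Ring.choose r (v + s) := by
  have := Ring.choose_smul_choose r (Nat.le_add_right v s)
  rw [nsmul_eq_mul, Nat.add_sub_cancel_left] at this
  exact this.symm

/-- Write `D = D₁ + D₂` for the actions on the two factors. The sum is the binomial expansion of
`(D₂ - (D₁ + D₂))^l = (-D₁)^l`. -/
theorem sum_antidiagonal_iterate_mul (l : ℕ) (p g : V) :
    ∑ x ∈ Finset.HasAntidiagonal.antidiagonal l,
      l.choose x.1 • ((-1 : ℤ) ^ x.1 • (D.toLinearMap ^ x.1) (p * (D.toLinearMap ^ x.2) g)) =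
    (-1 : ℤ) ^ l • ((D.toLinearMap ^ l) p * g) := by
  induction l generalizing g with
  | zero => simp
  | succ l ih =>
    rw [Finset.sum_antidiagonal_choose_succ_nsmul
      (fun i j => (-1 : ℤ) ^ i • (D.toLinearMap ^ i) (p * (D.toLinearMap ^ j) g))]
    have h1 : ∑ x ∈ Finset.HasAntidiagonal.antidiagonal l, l.choose x.1 •
        ((-1 : ℤ) ^ x.1 • (D.toLinearMap ^ x.1) (p * (D.toLinearMap ^ (x.2 + 1)) g)) =
        (-1 : ℤ) ^ l • ((D.toLinearMap ^ l) p * D g) := by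
      rw [← ih (D g)]
      rfl
    have h2 : ∑ x ∈ Finset.HasAntidiagonal.antidiagonal l, l.choose x.2 •
        ((-1 : ℤ) ^ (x.1 + 1) • (D.toLinearMap ^ (x.1 + 1)) (p * (D.toLinearMap ^ x.2) g)) =
        -D ((-1 : ℤ) ^ l • ((D.toLinearMap ^ l) p * g)) := by
      rw [← ih g, map_sum, ← Finset.sum_neg_distrib]
      refine Finset.sum_congr rfl fun x hx => ?_
      have hc : l.choose x.2 = l.choose x.1 := by
        rw [← Finset.HasAntidiagonal.mem_antidiagonal.1 hx, Nat.choose_symm_add]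
      rw [hc, map_nsmul, map_zsmul, ← smul_neg, pow_succ' (-1 : ℤ), mul_smul, neg_one_smul,
        pow_succ' D.toLinearMap]
      rfl
    rw [h1, h2, map_zsmul, D.leibniz, pow_succ' (-1 : ℤ), mul_smul, neg_one_smul,
      pow_succ' D.toLinearMap, Module.End.mul_apply, Derivation.coeFn_coe, smul_eq_mul,
      smul_eq_mul, smul_add, mul_comm g]
    abel

/-- Upper negation of the first factor makes this Vandermonde for `(-n - 1) + (m + n + 1 + l) = m +
l`. -/
theorem sum_antidiagonal_choose_mul_choose (n : ℕ) (m : ℤ) (l : ℕ) :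
    ∑ x ∈ Finset.HasAntidiagonal.antidiagonal l,
      Ring.choose ((n : ℤ) + x.1) x.1 * ((-1) ^ x.2 * Ring.choose (m + n + 1 + l) x.2) =
    (-1) ^ l * Ring.choose (m + l) l := by
  rw [show m + l = (-(n : ℤ) - 1) + (m + n + 1 + l) by ring,
    Ring.add_choose_eq l (Commute.all _ _), Finset.mul_sum]
  refine Finset.sum_congr rfl fun x hx => ?_
  have h := choose_sub_one_sub (-(n : ℤ) - 1) x.1
  rw [show (x.1 : ℤ) - 1 - (-n - 1) = n + x.1 by ring] at h
  rw [h, ← Finset.HasAntidiagonal.mem_antidiagonal.1 hx, pow_add]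
  ring

/-- The two sign changes cancel: `P*(λ - z) = ∑ₖ (z - λ - ∂)^k p_k`, whose `z^m` coefficient is read
off here. -/
theorem symbolReflect_adjoint (P : PseudoDiffOp D) (m : ℤ) :
    symbolReflect P.adjoint m 0 = ∑ᶠ l : ℕ, ((-1) ^ l * Ring.choose (m + l) l) •
      (lamD D ^ l) (Polynomial.C (P.coeff (m + l))) := by
  obtain ⟨N, hN⟩ := P.bounded
  let f : ℕ × ℕ → V[X] := fun x =>
    (((m.negOnePow : ℤ) * Ring.choose (m + x.1) x.1) *
      (((m + x.1 + x.2).negOnePow : ℤ) * Ring.choose (m + x.1 + x.2) x.2)) •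
      (Polynomial.C ((D.toLinearMap ^ x.2) (P.coeff (m + x.1 + x.2))) * Polynomial.X ^ x.1)
  have hf : f.HasFiniteSupport := by
    refine hasFiniteSupport_of_forall
      ((Set.finite_Iic (N - m).toNat).prod (Set.finite_Iic (N - m).toNat)) ?_
    rintro ⟨t, k⟩ h
    have : m + t + k ≤ N := by
      by_contra hc
      exact h (by simp [f, hN (m + t + k) (by omega)])
    simp only [Set.mem_prod, Set.mem_Iic]
    omega
  have h1 : symbolReflect P.adjoint m 0 = ∑ᶠ x, f x := by
    rw [finsum_curry f hf, symbolReflect, if_pos rfl]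
    refine finsum_congr fun t => ?_
    have hfin : (fun k : ℕ => (((m + t + k).negOnePow : ℤ) * Ring.choose (m + t + k) k) •
      (D.toLinearMap ^ k) (P.coeff (m + t + k))).HasFiniteSupport := by
      refine hasFiniteSupport_of_forall (Set.finite_Iic (N - m - t).toNat) fun k h => ?_
      have : m + t + k ≤ N := by
        by_contra hc
        exact h (by simp [hN (m + t + k) (by omega)])
      simp only [Set.mem_Iic]
      omega
    let φ : V →+ V[X] :=
      (DistribSMul.toAddMonoidHom V[X] ((m.negOnePow : ℤ) * Ring.choose (m + t) t)).comp
        ((AddMonoidHom.mulRight (Polynomial.X ^ t)).comp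
          (Polynomial.C : V →+* V[X]).toAddMonoidHom)
    change φ (P.adjoint.coeff (m + t)) = _
    rw [adjoint, φ.map_finsum hfin]
    refine finsum_congr fun k => ?_
    rw [map_zsmul]
    simp only [φ, f, AddMonoidHom.comp_apply, DistribSMul.toAddMonoidHom_apply]
    rw [smul_smul, mul_comm]
    rfl
  rw [h1, finsum_eq_finsum_antidiagonal f hf]
  refine finsum_congr fun l => ?_
  rw [lamD_pow_C, Finset.smul_sum]
  refine Finset.sum_congr rfl fun x hx => ?_
  have hl : (m + x.1 + x.2 : ℤ) = m + l := by
    rw [← Finset.HasAntidiagonal.mem_antidiagonal.1 hx]; push_cast; ring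
  simp only [f, hl]
  rw [← natCast_zsmul, smul_smul]
  congr 1
  have hsign : (m.negOnePow : ℤ) * ((m + l).negOnePow : ℤ) = (-1) ^ l := by
    rw [← Units.val_mul, ← Int.negOnePow_add, show m + (m + l) = m + m + l by ring,
      Int.negOnePow_add, Int.negOnePow_even (m + m) ⟨m, rfl⟩, one_mul, Int.coe_negOnePow_natCast]
  have hch := choose_mul_choose_sub (m + l) x.2 x.1
  rw [show m + (l : ℤ) - x.2 = m + x.1 by rw [← hl]; ring, add_comm x.2 x.1,
    Finset.HasAntidiagonal.mem_antidiagonal.1 hx] at hch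
  have hc : l.choose x.2 = l.choose x.1 := by
    rw [← Finset.HasAntidiagonal.mem_antidiagonal.1 hx, Nat.choose_symm_add]
  rw [hc] at hch
  rw [← hsign]
  linear_combination ((m.negOnePow : ℤ) * ((m + l).negOnePow : ℤ)) * hch

theorem symbolReflect_of_ne_zero (a : PseudoDiffOp D) (m : ℤ) {n : ℤ} (hn : n ≠ 0) :
    symbolReflect a m n = 0 := if_neg hn

theorem choose_natCast_eq_zero {p s : ℕ} (h : p < s) : Ring.choose (p : ℤ) s = 0 := by
  rw [Ring.choose_natCast, Nat.choose_eq_zero_of_lt h, Nat.cast_zero]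

/-- The resolvent involves only nonnegative powers of `w`. This is where the positive part
originates. -/
theorem resolvent_symbolReflect_of_neg (a : PseudoDiffOp D) (m : ℤ) {n : ℤ} (hn : n < 0) :
    resolvent D (symbolReflect a) m n = 0 := by
  refine finsum_eq_zero_of_forall_eq_zero fun p => finsum_eq_zero_of_forall_eq_zero fun s => ?_
  by_cases h : n - p + s = 0
  · rw [choose_natCast_eq_zero (by omega), zero_smul]
  · rw [symbolReflect_of_ne_zero _ _ h, map_zero, smul_zero]

/-- With `x = z - λ - ∂`, the kernel is `x^k / (x - w) = ∑ₙ wⁿ x^{k-n-1}` applied to `p_k`. The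
right side is the `z^m` coefficient of `x^{k-n-1}` with `k = m + n + 1 + l`. -/
theorem resolvent_symbolReflect (P : PseudoDiffOp D) (m : ℤ) (n : ℕ) :
    resolvent D (symbolReflect P.adjoint) m n =
      ∑ᶠ l : ℕ, ((-1) ^ l * Ring.choose (m + l) l) •
        (lamD D ^ l) (Polynomial.C (P.coeff (m + n + 1 + l))) := by
  obtain ⟨N, hN⟩ := P.bounded
  have hR : ∀ m', N < m' → symbolReflect P.adjoint m' 0 = 0 := fun m' h => by
    rw [symbolReflect_adjoint]
    refine finsum_eq_zero_of_forall_eq_zero fun l => ?_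
    rw [hN _ (by omega), map_zero, map_zero, smul_zero]
  let g : ℕ × ℕ → V[X] := fun x => Ring.choose (x.1 : ℤ) x.2 •
    (lamD D ^ x.2) (symbolReflect P.adjoint (m + x.1 + 1) (n - x.1 + x.2))
  have hg : g.HasFiniteSupport := by
    refine hasFiniteSupport_of_forall
      ((Set.finite_Iic (N - m).toNat).prod (Set.finite_Iic (N - m).toNat)) ?_
    rintro ⟨p, s⟩ h
    have h1 : (n : ℤ) - p + s = 0 := by
      by_contra hc
      exact h (by simp [g, symbolReflect_of_ne_zero _ _ hc])
    have h2 : m + p + 1 ≤ N := by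
      by_contra hc
      exact h (by simp only [g]; rw [h1, hR _ (by omega), map_zero, smul_zero])
    simp only [Set.mem_prod, Set.mem_Iic]
    omega
  let f : ℕ × ℕ → V[X] := fun x => (Ring.choose ((n : ℤ) + x.1) x.1 * ((-1) ^ x.2 *
    Ring.choose (m + n + 1 + x.1 + x.2) x.2)) •
      (lamD D ^ (x.1 + x.2)) (Polynomial.C (P.coeff (m + n + 1 + x.1 + x.2)))
  have hf : f.HasFiniteSupport := by
    refine hasFiniteSupport_of_forall
      ((Set.finite_Iic (N - m).toNat).prod (Set.finite_Iic (N - m).toNat)) ?_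
    rintro ⟨e, t⟩ h
    have : m + n + 1 + e + t ≤ N := by
      by_contra hc
      exact h (by simp [f, hN (m + n + 1 + e + t) (by omega)])
    simp only [Set.mem_prod, Set.mem_Iic]
    omega
  have h1 : resolvent D (symbolReflect P.adjoint) m n = ∑ᶠ s, ∑ᶠ p, g (p, s) :=
    finsum_prod_comm g hg
  have h2 : ∑ᶠ s, ∑ᶠ p, g (p, s) = ∑ᶠ x, f x := by
    rw [finsum_curry f hf]
    refine finsum_congr fun s => ?_
    -- The reflected symbol does not involve `w`, so `(λ + ∂)^s wⁿ` arises only from `(w + λ + ∂)^p`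
    -- with `p = n + s`.
    rw [finsum_eq_single _ (n + s)]
    · simp only [g]
      rw [show (n : ℤ) - (n + s : ℕ) + s = 0 by push_cast; ring, symbolReflect_adjoint]
      have hfin : (fun l : ℕ => ((-1) ^ l * Ring.choose (m + (n + s : ℕ) + 1 + l) l) •
          (lamD D ^ l) (Polynomial.C (P.coeff (m + (n + s : ℕ) + 1 + l)))).HasFiniteSupport := by
        refine hasFiniteSupport_of_forall (Set.finite_Iic (N - m).toNat) fun t h => ?_
        have : m + (n + s : ℕ) + 1 + t ≤ N := by
          by_contra hc
          exact h (by rw [hN _ (by omega), map_zero, map_zero, smul_zero])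
        simp only [Set.mem_Iic]
        omega
      rw [map_finsum _ hfin, smul_finsum' _ (hfin.fun_comp (map_zero _))]
      refine finsum_congr fun t => ?_
      rw [map_zsmul, smul_smul, ← Module.End.mul_apply, ← pow_add]
      simp only [f]
      rw [show m + ((n + s : ℕ) : ℤ) + 1 + t = m + n + 1 + s + t by push_cast; ring]
      push_cast
      rfl
    · intro p hp
      simp only [g]
      rw [symbolReflect_of_ne_zero _ _ (by omega), map_zero, smul_zero]
  rw [h1, h2, finsum_eq_finsum_antidiagonal f hf]
  refine finsum_congr fun l => ?_
  rw [← sum_antidiagonal_choose_mul_choose n m l, Finset.sum_smul]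
  refine Finset.sum_congr rfl fun x hx => ?_
  have hl : (m + n + 1 + x.1 + x.2 : ℤ) = m + n + 1 + l := by
    rw [← Finset.HasAntidiagonal.mem_antidiagonal.1 hx]; push_cast; ring
  simp only [f, hl]
  rw [Finset.HasAntidiagonal.mem_antidiagonal.1 hx]

theorem coeff_posPart (a : PseudoDiffOp D) (n : ℤ) :
    a.posPart.coeff n = if 0 ≤ n then a.coeff n else 0 := rfl

theorem resolvent_symbolReflect_eq_zero (P : PseudoDiffOp D) {N : ℤ} (hN : ∀ n, N < n → P.coeff n = 0)
    {m n : ℤ} (h : n < 0 ∨ N ≤ m + n) : resolvent D (symbolReflect P.adjoint) m n = 0 := by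
  by_cases hn : n < 0
  · exact resolvent_symbolReflect_of_neg _ _ hn
  · lift n to ℕ using by omega
    rw [resolvent_symbolReflect]
    refine finsum_eq_zero_of_forall_eq_zero fun l => ?_
    rw [hN _ (by omega), map_zero, map_zero, smul_zero]

/-- `Res_z` of the first Adler kernel applied to `G` is the positive part of `G P`. -/
theorem finsum_actOn_resolvent (P G : PseudoDiffOp D) (n : ℤ) :
    ∑ᶠ x : ℤ × ℕ, Ring.choose x.1 x.2 • actOn D ((D.toLinearMap ^ x.2) (G.coeff (-1 - x.1 + x.2)))
      (resolvent D (symbolReflect P.adjoint) x.1 n) = (G * P).posPart.coeff n := by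
  obtain ⟨N, hN⟩ := P.bounded
  obtain ⟨M, hM⟩ := G.bounded
  rw [coeff_posPart]
  split_ifs with hn
  swap
  · refine finsum_eq_zero_of_forall_eq_zero fun x => ?_
    rw [resolvent_symbolReflect_of_neg _ _ (by omega), map_zero, smul_zero]
  lift n to ℕ using hn
  let g : (ℤ × ℕ) × ℕ → V := fun x =>
    (Ring.choose x.1.1 x.1.2 * ((-1) ^ x.2 * Ring.choose (x.1.1 + x.2) x.2)) •
      (D.toLinearMap ^ x.2) (P.coeff (x.1.1 + n + 1 + x.2) *
        (D.toLinearMap ^ x.1.2) (G.coeff (-1 - x.1.1 + x.1.2)))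
  have hg : g.HasFiniteSupport := by
    refine hasFiniteSupport_of_forall
      ((finite_box (-1 - M) N (M + N + 1)).prod (Set.finite_Iic (N + M + 1).toNat)) ?_
    rintro ⟨⟨m, s⟩, v⟩ h
    have h1 : m + n + 1 + v ≤ N := by
      by_contra hc
      exact h (by simp [g, hN (m + n + 1 + v) (by omega)])
    have h2 : -1 - m + s ≤ M := by
      by_contra hc
      exact h (by simp [g, hM (-1 - m + s) (by omega)])
    simp only [Set.mem_prod, Set.mem_Iic, Set.mem_Icc]
    omega
  let f : ℤ × (ℕ × ℕ) → V := fun x =>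
    (Ring.choose (x.1 - x.2.1) x.2.2 * ((-1) ^ x.2.1 * Ring.choose x.1 x.2.1)) •
      (D.toLinearMap ^ x.2.1) (P.coeff (x.1 + n + 1) *
        (D.toLinearMap ^ x.2.2) (G.coeff (-1 - x.1 + x.2.1 + x.2.2)))
  -- Setting `r = m + v` makes the coefficient of `P` independent of `v` and `s`. The sum over `v +
  -- s = l` then collapses by `sum_antidiagonal_iterate_mul`.
  let e : ℤ × (ℕ × ℕ) ≃ (ℤ × ℕ) × ℕ :=
    { toFun := fun x => ((x.1 - x.2.1, x.2.2), x.2.1)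
      invFun := fun x => (x.1.1 + x.2, (x.2, x.1.2))
      left_inv := fun x => by simp
      right_inv := fun x => by simp }
  have hfg : ∀ x, g (e x) = f x := by
    rintro ⟨r, v, s⟩
    simp only [g, e, f, Equiv.coe_fn_mk, sub_add_cancel]
    rw [show r - (v : ℤ) + n + 1 + v = r + n + 1 by ring,
      show -1 - (r - (v : ℤ)) + s = -1 - r + v + s by ring]
  have hf : f.HasFiniteSupport := by
    rw [show f = fun x => g (e x) from funext fun x => (hfg x).symm]
    exact hg.comp_of_injective e.injective
  let t : ℤ × ℕ → V := fun x => ((-1) ^ x.2 * Ring.choose x.1 x.2) •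
    ((D.toLinearMap ^ x.2) (P.coeff (x.1 + n + 1)) * G.coeff (-1 - x.1 + x.2))
  have ht : t.HasFiniteSupport := by
    refine hasFiniteSupport_of_forall (finite_box (-1 - M) N (M + N + 1)) ?_
    rintro ⟨r, k⟩ h
    have h1 : r + n + 1 ≤ N := by
      by_contra hc
      exact h (by simp [t, hN (r + n + 1) (by omega)])
    have h2 : -1 - r + k ≤ M := by
      by_contra hc
      exact h (by simp [t, hM (-1 - r + k) (by omega)])
    simp only [Set.mem_prod, Set.mem_Iic, Set.mem_Icc]
    omega
  have h1 : ∑ᶠ x : ℤ × ℕ, Ring.choose x.1 x.2 •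
      actOn D ((D.toLinearMap ^ x.2) (G.coeff (-1 - x.1 + x.2)))
      (resolvent D (symbolReflect P.adjoint) x.1 n) = ∑ᶠ x, g x := by
    rw [finsum_curry g hg]
    refine finsum_congr ?_
    rintro ⟨m, s⟩
    have hfin : (fun l : ℕ => ((-1) ^ l * Ring.choose (m + l) l) •
        (lamD D ^ l) (Polynomial.C (P.coeff (m + n + 1 + l)))).HasFiniteSupport := by
      refine hasFiniteSupport_of_forall (Set.finite_Iic (N - m).toNat) fun t h => ?_
      have : m + n + 1 + t ≤ N := by
        by_contra hc
        exact h (by rw [hN _ (by omega), map_zero, map_zero, smul_zero])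
      simp only [Set.mem_Iic]
      omega
    rw [resolvent_symbolReflect, map_finsum _ hfin, smul_finsum' _ (hfin.fun_comp (map_zero _))]
    refine finsum_congr fun v => ?_
    rw [map_zsmul, actOn_lamD_pow, actOn_C, smul_smul]
  rw [h1, ← finsum_comp_equiv e, finsum_congr hfg, finsum_curry f hf]
  have h2 : ∀ r, ∑ᶠ y, f (r, y) = ∑ᶠ l, t (r, l) := by
    intro r
    rw [finsum_eq_finsum_antidiagonal _ (hasFiniteSupport_section hf r)]
    refine finsum_congr fun l => ?_
    have h := congrArg (fun y => Ring.choose r l • y) (sum_antidiagonal_iterate_mul (D := D) l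
      (P.coeff (r + n + 1)) (G.coeff (-1 - r + l)))
    simp only [smul_smul, Finset.smul_sum] at h
    simp only [t]
    rw [mul_comm, ← h]
    refine Finset.sum_congr rfl fun x hx => ?_
    have hx' := Finset.HasAntidiagonal.mem_antidiagonal.1 hx
    have hl : (-1 - r + x.1 + x.2 : ℤ) = -1 - r + l := by rw [← hx']; push_cast; ring
    simp only [f, hl]
    rw [← natCast_zsmul, smul_smul, smul_smul]
    congr 1
    have hch := choose_mul_choose_sub r x.1 x.2
    rw [hx'] at hch
    linear_combination (-1) ^ x.1 * hch
  rw [finsum_congr h2, ← finsum_curry t ht, coeff_mul]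
  -- The same reflection as for the trace property. Upper negation absorbs the sign and produces the
  -- binomials of `G ∘ P`.
  let e' : ℤ × ℕ ≃ ℤ × ℕ :=
    { toFun := fun x => (-1 - x.1 + x.2, x.2)
      invFun := fun x => (-1 - x.1 + x.2, x.2)
      left_inv := fun x => Prod.ext (by simp only; ring) rfl
      right_inv := fun x => Prod.ext (by simp only; ring) rfl }
  rw [← finsum_comp_equiv e']
  refine finsum_congr ?_
  rintro ⟨r, k⟩
  simp only [t, e', mulTerm, Equiv.coe_fn_mk]
  rw [show (-1 : ℤ) - (-1 - r + k) + k = r by ring,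
    show -1 - r + (k : ℤ) + n + 1 = n - r + k by ring,
    show (-1 : ℤ) - r + k = k - 1 - r by ring, choose_sub_one_sub, ← mul_assoc, ← pow_add,
    Even.neg_one_pow ⟨k, rfl⟩, one_mul, mul_comm (G.coeff r)]

theorem symbolShift_eq (Q : PseudoDiffOp D) {f : ℤ → V[X]} {M : ℤ} (hM : ∀ n, M < n → f n = 0)
    (n : ℤ) : symbolShift Q f n = ∑ᶠ q : ℤ, ∑ᶠ r : ℕ, Ring.choose q r •
      (Polynomial.C (Q.coeff q) * (lamD D ^ r) (f (n - q + r))) := by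
  refine finsum_congr fun q => ?_
  have hfin : (fun r : ℕ => Ring.choose q r • (lamD D ^ r) (f (n - q + r))).HasFiniteSupport := by
    refine hasFiniteSupport_of_forall (Set.finite_Iic (M - n + q).toNat) fun r h => ?_
    have : n - q + r ≤ M := by
      by_contra hc
      exact h (by rw [hM _ (by omega), map_zero, smul_zero])
    simp only [Set.mem_Iic]
    omega
  rw [shiftPow, mul_finsum' _ _ hfin]
  exact finsum_congr fun r => mul_smul_comm _ _ _

theorem finite_symbolShift_terms (Q : PseudoDiffOp D) {f : ℤ → V[X]} {M : ℤ}
    (hM : ∀ n, M < n → f n = 0) (n : ℤ) :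
    (fun x : ℤ × ℕ => Ring.choose x.1 x.2 •
      (Polynomial.C (Q.coeff x.1) * (lamD D ^ x.2) (f (n - x.1 + x.2)))).HasFiniteSupport := by
  obtain ⟨N, hN⟩ := Q.bounded
  refine hasFiniteSupport_of_forall (finite_box (n - M) N (M - n + N)) ?_
  rintro ⟨q, r⟩ h
  have h1 : q ≤ N := by
    by_contra hc
    exact h (by simp [hN q (by omega)])
  have h2 : n - q + r ≤ M := by
    by_contra hc
    exact h (by simp [hM (n - q + r) (by omega)])
  simp only [Set.mem_prod, Set.mem_Iic, Set.mem_Icc]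
  omega

theorem actOn_symbolShift (a : V) (Q : PseudoDiffOp D) {f : ℤ → V[X]} {M : ℤ}
    (hM : ∀ n, M < n → f n = 0) (n : ℤ) :
    actOn D a (symbolShift Q f n) = ∑ᶠ x : ℤ × ℕ, Ring.choose x.1 x.2 •
      (Q.coeff x.1 * (D.toLinearMap ^ x.2) (actOn D a (f (n - x.1 + x.2)))) := by
  have hfin := finite_symbolShift_terms Q hM n
  rw [symbolShift_eq Q hM, ← finsum_curry _ hfin, map_finsum _ hfin]
  refine finsum_congr fun x => ?_
  rw [map_zsmul, actOn_C_mul, actOn_lamD_pow]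

/-- Under `actOn` the shift `Q(w + λ + ∂)` becomes left composition with `Q`, so it passes through
the residue computed in `finsum_actOn_resolvent`. Finiteness is recorded too, because the two
kernels are subtracted termwise later. -/
theorem finsum_actOn_symbolShift_resolvent (P Q G : PseudoDiffOp D) (n : ℤ) :
    (fun x : ℤ × ℕ => Ring.choose x.1 x.2 •
      actOn D ((D.toLinearMap ^ x.2) (G.coeff (-1 - x.1 + x.2)))
        (symbolShift Q (resolvent D (symbolReflect P.adjoint) x.1) n)).HasFiniteSupport ∧
    ∑ᶠ x : ℤ × ℕ, Ring.choose x.1 x.2 •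
      actOn D ((D.toLinearMap ^ x.2) (G.coeff (-1 - x.1 + x.2)))
        (symbolShift Q (resolvent D (symbolReflect P.adjoint) x.1) n) =
      (Q * (G * P).posPart).coeff n := by
  obtain ⟨NP, hP⟩ := P.bounded
  obtain ⟨NQ, hQ⟩ := Q.bounded
  obtain ⟨NG, hG⟩ := G.bounded
  set R := resolvent D (symbolReflect P.adjoint) with hR
  have hRz : ∀ {m n : ℤ}, (n < 0 ∨ NP ≤ m + n) → R m n = 0 :=
    fun h => resolvent_symbolReflect_eq_zero P hP h
  let f : (ℤ × ℕ) × (ℤ × ℕ) → V := fun x => Ring.choose x.1.1 x.1.2 • (Ring.choose x.2.1 x.2.2 •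
    (Q.coeff x.2.1 * (D.toLinearMap ^ x.2.2) (actOn D ((D.toLinearMap ^ x.1.2)
      (G.coeff (-1 - x.1.1 + x.1.2))) (R x.1.1 (n - x.2.1 + x.2.2)))))
  have hf : f.HasFiniteSupport := by
    refine hasFiniteSupport_of_forall ((finite_box (-1 - NG) NP (NG + NP + 1)).prod
      (finite_box (n - NP - NG - 1) NQ (NP + NG + 1 + NQ - n))) ?_
    rintro ⟨⟨m, s⟩, ⟨q, r⟩⟩ h
    have h1 : q ≤ NQ := by
      by_contra hc
      exact h (by simp [f, hQ q (by omega)])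
    have h2 : -1 - m + s ≤ NG := by
      by_contra hc
      exact h (by simp [f, hG (-1 - m + s) (by omega), actOn_zero])
    have h3 : ¬ (n - q + r < 0 ∨ NP ≤ m + (n - q + r)) := fun hc =>
      h (by simp [f, hRz hc])
    simp only [Set.mem_prod, Set.mem_Iic, Set.mem_Icc]
    omega
  have h1 : ∀ x : ℤ × ℕ, Ring.choose x.1 x.2 •
      actOn D ((D.toLinearMap ^ x.2) (G.coeff (-1 - x.1 + x.2))) (symbolShift Q (R x.1) n) =
      ∑ᶠ y, f (x, y) := by
    intro x
    have hM : ∀ n', NP - x.1 < n' → R x.1 n' = 0 := fun n' h => hRz (by omega)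
    rw [actOn_symbolShift _ Q hM, smul_finsum']
    have := (finite_symbolShift_terms Q hM n).fun_comp
      (g := actOn D ((D.toLinearMap ^ x.2) (G.coeff (-1 - x.1 + x.2)))) (map_zero _)
    simpa only [map_zsmul, actOn_C_mul, actOn_lamD_pow] using this
  rw [finsum_congr h1, show (fun x : ℤ × ℕ => _ • _) = _ from funext h1]
  refine ⟨hasFiniteSupport_finsum hf, ?_⟩
  rw [finsum_prod_comm f hf, coeff_mul]
  refine finsum_congr ?_
  rintro ⟨q, r⟩
  rw [mulTerm, ← finsum_actOn_resolvent P G]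
  let φ : V →+ V := (DistribSMul.toAddMonoidHom V (Ring.choose q r)).comp
    ((AddMonoidHom.mulLeft (Q.coeff q)).comp (D.toLinearMap ^ r).toAddMonoidHom)
  have hfin : (fun x : ℤ × ℕ => Ring.choose x.1 x.2 •
      actOn D ((D.toLinearMap ^ x.2) (G.coeff (-1 - x.1 + x.2)))
        (R x.1 (n - q + r))).HasFiniteSupport := by
    refine hasFiniteSupport_of_forall (finite_box (-1 - NG) NP (NG + NP + 1)) ?_
    rintro ⟨m, s⟩ h
    have h2 : -1 - m + s ≤ NG := by
      by_contra hc
      exact h (by simp [hG (-1 - m + s) (by omega), actOn_zero])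
    have h3 : ¬ (n - q + r < 0 ∨ NP ≤ m + (n - q + r)) := fun hc =>
      h (by simp [hRz hc])
    simp only [Set.mem_prod, Set.mem_Iic, Set.mem_Icc]
    omega
  refine Eq.trans ?_ (φ.map_finsum hfin).symm
  refine finsum_congr fun x => ?_
  rw [map_zsmul]
  rfl

/-! ### The second Adler kernel. -/

theorem resolvent_symbolW (P : PseudoDiffOp D) (m n : ℤ) :
    resolvent D (symbolW P) m n =
      if m < 0 then shiftPow D (-1 - m) (fun k => Polynomial.C (P.coeff k)) n else 0 := by
  have h0 : ∀ p : ℕ, m + p + 1 ≠ 0 → shiftPow D p (symbolW P (m + p + 1)) n = 0 := by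
    intro p hp
    refine finsum_eq_zero_of_forall_eq_zero fun s => ?_
    rw [symbolW, if_neg hp, map_zero, smul_zero]
  split_ifs with hm
  · obtain ⟨p, hp⟩ : ∃ p : ℕ, (p : ℤ) = -1 - m := ⟨(-1 - m).toNat, by omega⟩
    rw [resolvent, finsum_eq_single _ p (fun p' hp' => h0 p' (by omega)), ← hp]
    congr 1
    funext k
    rw [symbolW, if_pos (by omega)]
  · exact finsum_eq_zero_of_forall_eq_zero fun p => h0 p (by omega)

/-- Upper negation of both factors gives the fixed upper indices `-a - 1` and `u + a - q`.
Vandermonde sums them to `u - 1 - q`, and a last negation returns to `q`. -/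
theorem sum_antidiagonal_choose_add_mul_choose (a q : ℤ) (u : ℕ) :
    ∑ x ∈ Finset.HasAntidiagonal.antidiagonal u,
      Ring.choose (a + x.1) x.1 * Ring.choose (q - a - x.1 - 1) x.2 = Ring.choose q u := by
  have h := choose_sub_one_sub q u
  have h' : Ring.choose q u = (-1) ^ u * Ring.choose ((u : ℤ) - 1 - q) u := by
    rw [h, ← mul_assoc, ← pow_add, Even.neg_one_pow ⟨u, rfl⟩, one_mul]
  rw [h', show (u : ℤ) - 1 - q = (-a - 1) + (u + a - q) by ring,
    Ring.add_choose_eq u (Commute.all _ _), Finset.mul_sum]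
  refine Finset.sum_congr rfl fun x hx => ?_
  have hx' := Finset.HasAntidiagonal.mem_antidiagonal.1 hx
  have h1 := choose_sub_one_sub (-a - 1) x.1
  have h2 := choose_sub_one_sub (u + a - q) x.2
  rw [show (x.1 : ℤ) - 1 - (-a - 1) = a + x.1 by ring] at h1
  rw [show (x.2 : ℤ) - 1 - (u + a - q) = q - a - x.1 - 1 by rw [← hx']; push_cast; ring] at h2
  rw [h1, h2, ← hx', pow_add]
  ring

/-- The contribution of `∂^q` to the second Adler kernel applied to `G`. -/
def kernelW (P : PseudoDiffOp D) (n q m : ℤ) (y : V) : V :=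
  if m < q then ∑ᶠ t : ℕ, Ring.choose (q - m - 1) t •
    (D.toLinearMap ^ t) (P.coeff (n + 1 + m - q + t) * y) else 0

theorem finite_kernelW_terms (P : PseudoDiffOp D) (n q m : ℤ) (y : V) :
    (fun x : ℕ × ℕ =>
      (if m < q then Ring.choose (q - m - 1) (x.1 + x.2) * ((x.1 + x.2).choose x.1 : ℤ) else 0) •
        ((D.toLinearMap ^ x.1) (P.coeff (n + 1 + m - q + x.1 + x.2)) *
          (D.toLinearMap ^ x.2) y)).HasFiniteSupport := by
  obtain ⟨N, hN⟩ := P.bounded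
  refine hasFiniteSupport_of_forall ((Set.finite_Iic (N - (n + 1 + m - q)).toNat).prod
    (Set.finite_Iic (N - (n + 1 + m - q)).toNat)) ?_
  rintro ⟨b, e⟩ h
  have : n + 1 + m - q + b + e ≤ N := by
    by_contra hc
    exact h (by simp [hN (n + 1 + m - q + b + e) (by omega)])
  simp only [Set.mem_prod, Set.mem_Iic]
  omega

theorem kernelW_eq (P : PseudoDiffOp D) (n q m : ℤ) (y : V) :
    kernelW P n q m y = ∑ᶠ x : ℕ × ℕ,
      (if m < q then Ring.choose (q - m - 1) (x.1 + x.2) * ((x.1 + x.2).choose x.1 : ℤ) else 0) •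
        ((D.toLinearMap ^ x.1) (P.coeff (n + 1 + m - q + x.1 + x.2)) *
          (D.toLinearMap ^ x.2) y) := by
  rw [finsum_eq_finsum_antidiagonal _ (finite_kernelW_terms P n q m y), kernelW]
  split_ifs
  · refine finsum_congr fun t => ?_
    rw [iterate_leibniz, Finset.smul_sum]
    refine Finset.sum_congr rfl fun x hx => ?_
    have hx' := Finset.HasAntidiagonal.mem_antidiagonal.1 hx
    rw [← natCast_zsmul, smul_smul, hx',
      show n + 1 + m - q + (x.1 : ℤ) + x.2 = n + 1 + m - q + t by rw [← hx']; push_cast; ring]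
  · refine (finsum_eq_zero_of_forall_eq_zero fun t => ?_).symm
    exact Finset.sum_eq_zero fun x _ => zero_smul _ _

/-- The right side is the coefficient of `∂ⁿ` in `(∂^q ∘ G)₊ ∘ P`; the case of general `Q` follows
by linearity in `∂^q`. -/
theorem finsum_kernelW (P G : PseudoDiffOp D) (n q : ℤ) :
    ∑ᶠ x : ℤ × ℕ, Ring.choose x.1 x.2 •
      kernelW P n q x.1 ((D.toLinearMap ^ x.2) (G.coeff (-1 - x.1 + x.2))) =
    ∑ᶠ x : ℤ × ℕ, Ring.choose x.1 x.2 •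
      ((if 0 ≤ x.1 then ∑ᶠ u : ℕ, Ring.choose q u •
        (D.toLinearMap ^ u) (G.coeff (x.1 - q + u)) else 0) *
          (D.toLinearMap ^ x.2) (P.coeff (n - x.1 + x.2))) := by
  obtain ⟨NP, hP⟩ := P.bounded
  obtain ⟨NG, hG⟩ := G.bounded
  let g : (ℤ × ℕ) × (ℕ × ℕ) → V := fun x =>
    (Ring.choose x.1.1 x.1.2 * (if x.1.1 < q then
      Ring.choose (q - x.1.1 - 1) (x.2.1 + x.2.2) * ((x.2.1 + x.2.2).choose x.2.1 : ℤ) else 0)) •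
      ((D.toLinearMap ^ x.2.1) (P.coeff (n + 1 + x.1.1 - q + x.2.1 + x.2.2)) *
        (D.toLinearMap ^ x.2.2) ((D.toLinearMap ^ x.1.2) (G.coeff (-1 - x.1.1 + x.1.2))))
  have hg : g.HasFiniteSupport := by
    refine hasFiniteSupport_of_forall ((finite_box (-1 - NG) q (NG + 1 + q)).prod
      ((Set.finite_Iic (NP - n - 1 + q + NG + 1).toNat).prod
        (Set.finite_Iic (NP - n - 1 + q + NG + 1).toNat))) ?_
    rintro ⟨⟨m, s⟩, b, e⟩ h
    have h1 : n + 1 + m - q + b + e ≤ NP := by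
      by_contra hc
      exact h (by simp [g, hP (n + 1 + m - q + b + e) (by omega)])
    have h2 : -1 - m + s ≤ NG := by
      by_contra hc
      exact h (by simp [g, hG (-1 - m + s) (by omega)])
    have h3 : m < q := by
      by_contra hc
      exact h (by simp [g, hc])
    simp only [Set.mem_prod, Set.mem_Iic, Set.mem_Icc]
    omega
  let f : (ℤ × ℕ) × (ℕ × ℕ) → V := fun x =>
    (if 0 ≤ x.1.1 then Ring.choose x.1.1 x.1.2 * (Ring.choose (x.1.1 + x.2.1) x.2.1 *
      Ring.choose (q - x.1.1 - x.2.1 - 1) x.2.2) else 0) •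
      ((D.toLinearMap ^ (x.2.1 + x.2.2)) (G.coeff (x.1.1 - q + x.2.1 + x.2.2)) *
        (D.toLinearMap ^ x.1.2) (P.coeff (n - x.1.1 + x.1.2)))
  -- Of the derivatives in the kernel, `b` fall on `P` and `e` on `G`. The new index `a = q - m - 1
  -- - e` is the order in `∂^q ∘ G` that the term contributes to.
  let ε : (ℤ × ℕ) × (ℕ × ℕ) ≃ (ℤ × ℕ) × (ℕ × ℕ) :=
    { toFun := fun x => ((q - x.1.1 - x.2.1 - 1, x.2.2), (x.1.2, x.2.1))
      invFun := fun x => ((q - x.1.1 - x.2.2 - 1, x.2.1), (x.2.2, x.1.2))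
      left_inv := fun x => Prod.ext (Prod.ext (by simp only; ring) rfl) rfl
      right_inv := fun x => Prod.ext (Prod.ext (by simp only; ring) rfl) rfl }
  have hfg : ∀ x, g (ε x) = f x := by
    rintro ⟨⟨a, b⟩, e, s⟩
    simp only [g, ε, f, Equiv.coe_fn_mk]
    rw [show n + 1 + (q - a - (e : ℤ) - 1) - q + b + e = n - a + b by ring,
      show -1 - (q - a - (e : ℤ) - 1) + s = a - q + e + s by ring,
      show q - (q - a - (e : ℤ) - 1) - 1 = a + e by ring, ← Module.End.mul_apply, ← pow_add,
      mul_comm ((D.toLinearMap ^ b) _)]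
    congr 1
    by_cases ha : 0 ≤ a
    · rw [if_pos ha, if_pos (by omega)]
      have h := choose_mul_choose_sub (a + e) e b
      rw [add_sub_cancel_right, add_comm e b, Nat.choose_symm_add.symm] at h
      linear_combination -Ring.choose (q - a - (e : ℤ) - 1) s * h
    -- The kernel only imposes `m < q`, that is `a + e ≥ 0`. In the extra range `-e ≤ a < 0` the
    -- binomial `a + e` over `e + b` vanishes, which sharpens the condition to the truncation `a ≥
    -- 0`.
    · rw [if_neg ha]
      split_ifs with h
      · obtain ⟨p, hp⟩ : ∃ p : ℕ, (p : ℤ) = a + e := ⟨(a + e).toNat, by omega⟩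
        rw [← hp, choose_natCast_eq_zero (by omega), zero_mul, mul_zero]
      · rw [mul_zero]
  have hf : f.HasFiniteSupport := by
    rw [show f = fun x => g (ε x) from funext fun x => (hfg x).symm]
    exact hg.comp_of_injective ε.injective
  have h1 : ∀ x : ℤ × ℕ, Ring.choose x.1 x.2 •
      kernelW P n q x.1 ((D.toLinearMap ^ x.2) (G.coeff (-1 - x.1 + x.2))) = ∑ᶠ y, g (x, y) := by
    intro x
    rw [kernelW_eq]
    rw [smul_finsum' _ (finite_kernelW_terms P n q x.1 _)]
    exact finsum_congr fun y => smul_smul _ _ _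
  rw [finsum_congr h1, ← finsum_curry g hg, ← finsum_comp_equiv ε, finsum_congr hfg,
    finsum_curry f hf]
  refine finsum_congr ?_
  rintro ⟨a, b⟩
  rw [finsum_eq_finsum_antidiagonal _ (hasFiniteSupport_section hf _)]
  by_cases ha : 0 ≤ a
  swap
  · simp [f, ha]
  have hfin : (fun u : ℕ => Ring.choose q u •
      (D.toLinearMap ^ u) (G.coeff (a - q + u))).HasFiniteSupport := by
    refine hasFiniteSupport_of_forall (Set.finite_Iic (NG - a + q).toNat) fun u h => ?_
    have : a - q + u ≤ NG := by
      by_contra hc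
      exact h (by rw [hG _ (by omega), map_zero, smul_zero])
    simp only [Set.mem_Iic]
    omega
  simp only [if_pos ha]
  let φ : V →+ V := (DistribSMul.toAddMonoidHom V (Ring.choose a b)).comp
    (AddMonoidHom.mulRight ((D.toLinearMap ^ b) (P.coeff (n - a + b))))
  refine Eq.trans ?_ (φ.map_finsum hfin).symm
  refine finsum_congr fun u => ?_
  rw [map_zsmul, ← sum_antidiagonal_choose_add_mul_choose a q u, Finset.sum_smul]
  refine Finset.sum_congr rfl fun x hx => ?_
  have hx' := Finset.HasAntidiagonal.mem_antidiagonal.1 hx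
  simp only [f, if_pos ha, φ, AddMonoidHom.comp_apply, DistribSMul.toAddMonoidHom_apply,
    AddMonoidHom.coe_mulRight, smul_smul]
  rw [hx', show a - q + (x.1 : ℤ) + x.2 = a - q + u by rw [← hx']; push_cast; ring, mul_comm]

theorem actOn_symbolMul (a : V) (P Q : PseudoDiffOp D) (m n : ℤ) :
    actOn D a (symbolMul Q (resolvent D (symbolW P)) m n) =
      ∑ᶠ q, Q.coeff q * kernelW P n q m a := by
  obtain ⟨NP, hP⟩ := P.bounded
  obtain ⟨NQ, hQ⟩ := Q.bounded
  rw [symbolMul, map_finsum]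
  · refine finsum_congr fun q => ?_
    rw [actOn_C_mul, resolvent_symbolW, kernelW]
    congr 1
    by_cases h : m < q
    · rw [if_pos h, if_pos (by omega), shiftPow, map_finsum]
      · refine finsum_congr fun t => ?_
        rw [map_zsmul, actOn_lamD_pow, actOn_C, show -1 - (m - q) = q - m - 1 by ring,
          show n - (q - m - 1) + (t : ℤ) = n + 1 + m - q + t by ring]
      · refine hasFiniteSupport_of_forall (Set.finite_Iic (NP - (n - (-1 - (m - q)))).toNat)
          fun t ht => ?_
        have : n - (-1 - (m - q)) + t ≤ NP := by
          by_contra hc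
          exact ht (by rw [hP _ (by omega), map_zero, map_zero, smul_zero])
        simp only [Set.mem_Iic]
        omega
    · rw [if_neg h, if_neg (by omega), map_zero]
  · refine hasFiniteSupport_of_forall (Set.finite_Icc m NQ) fun q h => ?_
    have h1 : q ≤ NQ := by
      by_contra hc
      exact h (by rw [hQ _ (by omega), map_zero, zero_mul])
    have h2 : m < q := by
      by_contra hc
      exact h (by rw [resolvent_symbolW, if_neg (by omega), mul_zero])
    simp only [Set.mem_Icc]
    omega

theorem kernelW_zero (P : PseudoDiffOp D) (n q m : ℤ) : kernelW P n q m 0 = 0 := by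
  rw [kernelW]
  split_ifs
  · exact finsum_eq_zero_of_forall_eq_zero fun t => by rw [mul_zero, map_zero, smul_zero]
  · rfl

theorem finsum_actOn_symbolMul_resolvent (P Q G : PseudoDiffOp D) (n : ℤ) :
    (fun x : ℤ × ℕ => Ring.choose x.1 x.2 •
      actOn D ((D.toLinearMap ^ x.2) (G.coeff (-1 - x.1 + x.2)))
        (symbolMul Q (resolvent D (symbolW P)) x.1 n)).HasFiniteSupport ∧
    ∑ᶠ x : ℤ × ℕ, Ring.choose x.1 x.2 •
      actOn D ((D.toLinearMap ^ x.2) (G.coeff (-1 - x.1 + x.2)))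
        (symbolMul Q (resolvent D (symbolW P)) x.1 n) =
      ((Q * G).posPart * P).coeff n := by
  obtain ⟨NP, hP⟩ := P.bounded
  obtain ⟨NQ, hQ⟩ := Q.bounded
  obtain ⟨NG, hG⟩ := G.bounded
  let y : ℤ × ℕ → V := fun x => (D.toLinearMap ^ x.2) (G.coeff (-1 - x.1 + x.2))
  have hker : ∀ q : ℤ, ∀ x : ℤ × ℕ, kernelW P n q x.1 (y x) ≠ 0 →
      -1 - NG ≤ x.1 ∧ x.1 < q ∧ (x.2 : ℤ) ≤ NG + 1 + q := by
    rintro q ⟨m, s⟩ h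
    have h2 : -1 - m + s ≤ NG := by
      by_contra hc
      exact h (by simp only [y]; rw [hG _ (by omega), map_zero, kernelW_zero])
    have h3 : m < q := by
      by_contra hc
      exact h (if_neg hc)
    simp only
    omega
  let f : (ℤ × ℕ) × ℤ → V := fun x => Ring.choose x.1.1 x.1.2 •
    (Q.coeff x.2 * kernelW P n x.2 x.1.1 (y x.1))
  have hf : f.HasFiniteSupport := by
    refine hasFiniteSupport_of_forall ((finite_box (-1 - NG) NQ (NG + 1 + NQ)).prod
      (Set.finite_Icc (-1 - NG) NQ)) ?_
    rintro ⟨⟨m, s⟩, q⟩ h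
    have h1 : q ≤ NQ := by
      by_contra hc
      exact h (by simp [f, hQ q (by omega)])
    have h2 := hker q (m, s) (fun hc => h (by simp [f, hc]))
    simp only at h2
    simp only [Set.mem_prod, Set.mem_Iic, Set.mem_Icc]
    omega
  have hfq : ∀ x : ℤ × ℕ, (fun q => Q.coeff q * kernelW P n q x.1 (y x)).HasFiniteSupport := by
    intro x
    refine hasFiniteSupport_of_forall (Set.finite_Icc (-1 - NG) NQ) fun q h => ?_
    have h1 : q ≤ NQ := by
      by_contra hc
      exact h (by simp [hQ q (by omega)])
    have h2 := hker q x (fun hc => h (by simp [hc]))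
    simp only [Set.mem_Icc]
    omega
  have h1 : ∀ x : ℤ × ℕ, Ring.choose x.1 x.2 •
      actOn D ((D.toLinearMap ^ x.2) (G.coeff (-1 - x.1 + x.2)))
        (symbolMul Q (resolvent D (symbolW P)) x.1 n) = ∑ᶠ q, f (x, q) := by
    intro x
    rw [actOn_symbolMul, smul_finsum' _ (hfq x)]
  rw [finsum_congr h1, show (fun x : ℤ × ℕ => _ • _) = _ from funext h1]
  refine ⟨hasFiniteSupport_finsum hf, ?_⟩
  rw [finsum_prod_comm f hf]
  let z : ℤ → ℤ → V := fun a q => if 0 ≤ a then ∑ᶠ u : ℕ, Ring.choose q u •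
    (D.toLinearMap ^ u) (G.coeff (a - q + u)) else 0
  have hz : ∀ a q, z a q ≠ 0 → 0 ≤ a ∧ a - q ≤ NG := by
    intro a q h
    have ha : 0 ≤ a := by
      by_contra hc
      exact h (if_neg hc)
    refine ⟨ha, ?_⟩
    by_contra hc
    refine h ?_
    simp only [z, if_pos ha]
    exact finsum_eq_zero_of_forall_eq_zero fun u => by
      rw [hG _ (by omega), map_zero, smul_zero]
  let w : (ℤ × ℕ) × ℤ → V := fun x => Ring.choose x.1.1 x.1.2 •
    (Q.coeff x.2 * z x.1.1 x.2 * (D.toLinearMap ^ x.1.2) (P.coeff (n - x.1.1 + x.1.2)))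
  have hw : w.HasFiniteSupport := by
    refine hasFiniteSupport_of_forall ((finite_box 0 (NQ + NG) (NP - n + NQ + NG)).prod
      (Set.finite_Icc (-NG) NQ)) ?_
    rintro ⟨⟨a, b⟩, q⟩ h
    have h1 : q ≤ NQ := by
      by_contra hc
      exact h (by simp [w, hQ q (by omega)])
    have h2 := hz a q (fun hc => h (by simp [w, hc]))
    have h3 : n - a + b ≤ NP := by
      by_contra hc
      exact h (by simp [w, hP (n - a + b) (by omega)])
    simp only [Set.mem_prod, Set.mem_Iic, Set.mem_Icc]
    omega
  have h2 : ∀ q, ∑ᶠ x, f (x, q) = ∑ᶠ x, w (x, q) := by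
    intro q
    have hfin : (fun x : ℤ × ℕ => Ring.choose x.1 x.2 •
        kernelW P n q x.1 (y x)).HasFiniteSupport := by
      refine hasFiniteSupport_of_forall (finite_box (-1 - NG) q (NG + 1 + q)) fun x h => ?_
      have h2 := hker q x (fun hc => h (by simp [hc]))
      simp only [Set.mem_prod, Set.mem_Iic, Set.mem_Icc]
      omega
    have hfin' : (fun x : ℤ × ℕ => Ring.choose x.1 x.2 •
        (z x.1 q * (D.toLinearMap ^ x.2) (P.coeff (n - x.1 + x.2)))).HasFiniteSupport := by
      refine hasFiniteSupport_of_forall (finite_box 0 (q + NG) (NP - n + q + NG)) ?_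
      rintro ⟨a, b⟩ h
      have h2 := hz a q (fun hc => h (by simp [hc]))
      have h3 : n - a + b ≤ NP := by
        by_contra hc
        exact h (by simp [hP (n - a + b) (by omega)])
      simp only [Set.mem_prod, Set.mem_Iic, Set.mem_Icc]
      omega
    have h := congrArg (fun v => Q.coeff q * v) (finsum_kernelW P G n q)
    rw [mul_finsum' _ _ hfin, mul_finsum' _ _ hfin'] at h
    refine Eq.trans (finsum_congr fun x => ?_) (h.trans (finsum_congr fun x => ?_))
    · exact (mul_smul_comm _ _ _).symm
    · rw [mul_smul_comm, ← mul_assoc]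
  rw [finsum_congr h2, ← finsum_prod_comm w hw, coeff_mul]
  refine finsum_congr ?_
  rintro ⟨a, b⟩
  rw [mulTerm, coeff_posPart]
  by_cases ha : 0 ≤ a
  swap
  · simp [w, z, ha]
  simp only [if_pos ha]
  have hQG : (Q * G).coeff a = ∑ᶠ q, Q.coeff q * z a q := by
    rw [coeff_mul, finsum_curry _ (mulTerm_finite Q G a)]
    refine finsum_congr fun q => ?_
    simp only [z, if_pos ha]
    rw [mul_finsum']
    · exact finsum_congr fun u => (mul_smul_comm _ _ _).symm
    · refine hasFiniteSupport_of_forall (Set.finite_Iic (NG - a + q).toNat) fun u h => ?_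
      have : a - q + u ≤ NG := by
        by_contra hc
        exact h (by rw [hG _ (by omega), map_zero, smul_zero])
      simp only [Set.mem_Iic]
      omega
  have hfin : (fun q => Q.coeff q * z a q).HasFiniteSupport := by
    refine hasFiniteSupport_of_forall (Set.finite_Icc (a - NG) NQ) fun q h => ?_
    have h1 : q ≤ NQ := by
      by_contra hc
      exact h (by simp [hQ q (by omega)])
    have h2 := hz a q (fun hc => h (by simp [hc]))
    simp only [Set.mem_Icc]
    omega
  let φ : V →+ V := (DistribSMul.toAddMonoidHom V (Ring.choose a b)).comp
    (AddMonoidHom.mulRight ((D.toLinearMap ^ b) (P.coeff (n - a + b))))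
  rw [hQG]
  exact (φ.map_finsum hfin).symm

/-! ### The Lax equation. -/

variable {N : ℕ}

/-- The nonnegative part as an additive map. -/
def posPartHom (D : Derivation F V V) : PseudoDiffOp D →+ PseudoDiffOp D where
  toFun := posPart
  map_zero' := PseudoDiffOp.ext (funext fun n => by rw [coeff_posPart, coeff_zero, ite_self])
  map_add' a b := PseudoDiffOp.ext (funext fun n => by
    simp only [coeff_posPart, coeff_add]
    split_ifs <;> simp)

theorem posPart_sum {ι : Type*} (s : Finset ι) (f : ι → PseudoDiffOp D) :
    (∑ i ∈ s, f i).posPart = ∑ i ∈ s, (f i).posPart := map_sum (posPartHom D) f s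

/-- The pairing of an operator of Adler type with `G`, entry by entry. -/
theorem pairing_adler {lb : LambdaBracket D} {A : MatPseudoDiffOp N D} (hA : IsAdlerType lb A)
    (i j h k : Fin N) (n : ℤ) (G : PseudoDiffOp D) :
    pairing (bracketPairing lb ((A h k).coeff n)) (A i j) G =
      (A h j * (G * A i k).posPart).coeff n - ((A h j * G).posPart * A i k).coeff n := by
  obtain ⟨hf1, h1⟩ := finsum_actOn_symbolShift_resolvent (A i k) (A h j) G n
  obtain ⟨hf2, h2⟩ := finsum_actOn_symbolMul_resolvent (A i k) (A h j) G n
  rw [← h1, ← h2, ← finsum_sub_distrib hf1 hf2, pairing]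
  refine finsum_congr fun x => ?_
  rw [bracketPairing_apply, hA, map_sub, smul_sub]

theorem sum_pairing_adler {lb : LambdaBracket D} {A : MatPseudoDiffOp N D}
    (hA : IsAdlerType lb A) (h k : Fin N) (n : ℤ) (G : MatPseudoDiffOp N D) :
    ∑ i, ∑ j, pairing (bracketPairing lb ((A h k).coeff n)) (A i j) (G j i) =
      ((A * (G * A).map posPart - (A * G).map posPart * A) h k).coeff n := by
  simp only [pairing_adler hA, Finset.sum_sub_distrib]
  rw [Matrix.sub_apply, coeff_sub, Matrix.mul_apply, Matrix.mul_apply, coeff_sum, coeff_sum]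
  congr 1
  · rw [Finset.sum_comm]
    refine Finset.sum_congr rfl fun j _ => ?_
    rw [Matrix.map_apply, Matrix.mul_apply, posPart_sum, Finset.mul_sum, coeff_sum]
  · refine Finset.sum_congr rfl fun i _ => ?_
    rw [Matrix.map_apply, Matrix.mul_apply, posPart_sum, Finset.sum_mul, coeff_sum]

theorem intPow_unit {R : Type*} [Ring R] (u : Rˣ) (n : ℤ) : intPow (u : R) n = ↑(u ^ n) := by
  cases n with
  | ofNat k => rw [intPow, Int.ofNat_eq_natCast, zpow_natCast, Units.val_pow_eq_pow_val]
  | negSucc k =>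
    rw [intPow, Ring.inverse_unit, zpow_negSucc, ← inv_pow, Units.val_pow_eq_pow_val]

/-- For `K > 0` the root is invertible because its power `A` is. For `K < 0` invertibility belongs
to `IsRoot`, since `Ring.inverse` takes the default value `0` off the units. -/
theorem IsRoot.exists_unit {A B : MatPseudoDiffOp N D} {K : ℤ} (h : IsRoot A K B)
    (hA : IsUnit A) : ∃ u : (MatPseudoDiffOp N D)ˣ, (u : MatPseudoDiffOp N D) = B ∧
      (↑(u ^ K) : MatPseudoDiffOp N D) = A := by
  obtain ⟨hK, hneg, hpow⟩ := h
  have hB : IsUnit B := by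
    rcases lt_or_gt_of_ne hK with hlt | hgt
    · exact hneg hlt
    · lift K to ℕ using hgt.le
      have hp : B ^ K = A := hpow
      rw [← hp] at hA
      exact (isUnit_pow_iff (by omega)).1 hA
  obtain ⟨u, rfl⟩ := hB
  exact ⟨u, rfl, by rw [← intPow_unit, hpow]⟩

theorem flow_eq_bracketPairing (lb : LambdaBracket D) (f c : V) :
    lb.flow (integral D f) c = bracketPairing lb c 1 f := by
  rw [bracketPairing_apply, actOn_one, lb.flow_integral]

theorem hamDensity_zero (K : ℤ) (B : MatPseudoDiffOp N D) : hamDensity K B 0 = 0 := if_pos rfl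

theorem neg_div_smul_eq [CharZero F] {E : Type*} [AddCommGroup E] [Module F E] {K n : ℤ}
    (hn : n ≠ 0) {x y : E} (h : K • x = n • y) : (-(K : F) / (n : F)) • x = -y := by
  have hn' : (n : F) ≠ 0 := Int.cast_ne_zero.2 hn
  rw [← Int.cast_smul_eq_zsmul F, ← Int.cast_smul_eq_zsmul F] at h
  rw [div_eq_inv_mul, mul_smul, neg_smul, h, smul_neg, smul_smul, inv_mul_cancel₀ hn', one_smul]

/-- The chain rule is applied to the bracket pairing at `a = 1`, one coefficient of `A` at a time.
With `G = B^{n-K}`, both truncated products in `sum_pairing_adler` are `Bⁿ`. -/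
theorem lax_equation [CharZero F] {lb : LambdaBracket D} {A : MatPseudoDiffOp N D}
    (hA : IsAdlerType lb A) (hinv : IsUnit A) {K : ℤ} {B : MatPseudoDiffOp N D}
    (hB : IsRoot A K B) (n : ℤ) :
    A.map (mapCoeff (lb.flow (integral D (hamDensity K B n)))) =
      ⁅(intPow B n).map posPart, A⁆ := by
  obtain ⟨u, rfl, hu⟩ := hB.exists_unit hinv
  rcases eq_or_ne n 0 with rfl | hn
  -- For `n = 0` the density is zero by convention, and `(B⁰)₊ = 1` commutes with `A`.
  · have h1 : (intPow (u : MatPseudoDiffOp N D) 0).map posPart = 1 := by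
      rw [intPow_unit, zpow_zero, Units.val_one]
      refine Matrix.ext fun i j => PseudoDiffOp.ext (funext fun m => ?_)
      rw [Matrix.map_apply, coeff_posPart, Matrix.one_apply]
      by_cases hij : i = j
      · rw [if_pos hij, coeff_one]
        split_ifs <;> first | rfl | omega
      · rw [if_neg hij, coeff_zero, ite_self]
    rw [h1, Ring.lie_def, one_mul, mul_one, sub_self, hamDensity_zero, map_zero, map_zero]
    exact Matrix.ext fun i j => PseudoDiffOp.ext rfl
  refine Matrix.ext fun h k => PseudoDiffOp.ext (funext fun m => ?_)
  have hchain := pairing_zpow (isDerivationPairing_bracket lb ((A h k).coeff m)) u K n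
  rw [hu, sum_pairing_adler hA] at hchain
  have hcomm1 : (↑(u ^ (n - K)) : MatPseudoDiffOp N D) * A = ↑(u ^ n) := by
    rw [← hu, ← Units.val_mul, ← zpow_add, sub_add_cancel]
  have hcomm2 : A * (↑(u ^ (n - K)) : MatPseudoDiffOp N D) = ↑(u ^ n) := by
    rw [← hu, ← Units.val_mul, ← zpow_add, add_sub_cancel]
  rw [hcomm1, hcomm2] at hchain
  change lb.flow (integral D (hamDensity K _ n)) ((A h k).coeff m) = _
  rw [hamDensity, if_neg hn, intPow_unit, map_smul, map_smul, LinearMap.smul_apply,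
    flow_eq_bracketPairing, neg_div_smul_eq hn hchain, Ring.lie_def, Matrix.sub_apply,
    Matrix.sub_apply, coeff_sub, coeff_sub, neg_sub]

/-! ### Flows as derivations, and the conservation of traces of powers. -/

theorem flow_mul (lb : LambdaBracket D) (H : Functionals D) (a b : V) :
    lb.flow H (a * b) = a * lb.flow H b + b * lb.flow H a := by
  obtain ⟨f, rfl⟩ := Submodule.mkQ_surjective _ H
  change (lb.br f (a * b)).coeff 0 = a * (lb.br f b).coeff 0 + b * (lb.br f a).coeff 0
  rw [lb.leibniz_right, Polynomial.coeff_add, Polynomial.coeff_mul_C, Polynomial.coeff_mul_C]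
  ring

theorem flow_D (lb : LambdaBracket D) (H : Functionals D) (a : V) :
    lb.flow H (D a) = D (lb.flow H a) := by
  obtain ⟨f, rfl⟩ := Submodule.mkQ_surjective _ H
  change (lb.br f (D a)).coeff 0 = D ((lb.br f a).coeff 0)
  rw [lb.sesq_right, lamD, LinearMap.add_apply, Polynomial.coeff_add, coeff_polyD]
  simp

/-- The pairing `(a, b) ↦ ∫ a δ(b)` for a linear map `δ`. -/
def integralPairing (δ : V →ₗ[F] V) : V →+ V →+ Functionals D where
  toFun a := (integral D).toAddMonoidHom.comp ((AddMonoidHom.mulLeft a).comp δ.toAddMonoidHom)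
  map_zero' := AddMonoidHom.ext fun _ => by simp
  map_add' a a' := AddMonoidHom.ext fun _ => by simp [add_mul]

theorem integralPairing_apply (δ : V →ₗ[F] V) (a b : V) :
    integralPairing (D := D) δ a b = integral D (a * δ b) := rfl

theorem isDerivationPairing_integral {δ : V →ₗ[F] V}
    (hmul : ∀ a b, δ (a * b) = a * δ b + b * δ a) (hD : ∀ a, δ (D a) = D (δ a)) :
    IsDerivationPairing D (integralPairing (D := D) δ) where
  mul a b c := by
    simp only [integralPairing_apply]
    rw [hmul, ← map_add]
    congr 1
    ring
  deriv a b := by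
    simp only [integralPairing_apply]
    rw [hD, eq_neg_iff_add_eq_zero, ← map_add, ← integral_D D (a * δ b), D.leibniz, smul_eq_mul,
      smul_eq_mul, mul_comm (δ b)]

theorem pairing_integral (δ : V →ₗ[F] V) (X G : PseudoDiffOp D) :
    pairing (integralPairing (D := D) δ) X G = integral D (mapCoeff δ X * G).residue := by
  rw [residue, coeff_mul, map_finsum _ (mulTerm_finite _ _ _), pairing]
  refine finsum_congr fun p => ?_
  rw [integralPairing_apply, mulTerm, map_zsmul, mul_comm]
  rfl

/-- Only the Lax form of the flow is used, with arbitrary `P`: `tr(PAG) - tr(APG)` vanishes modulo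
total derivatives, since `G = C^{n-L}` commutes with `A = C^L`. -/
theorem integral_flow_hamDensity [CharZero F] {lb : LambdaBracket D} {A P : MatPseudoDiffOp N D}
    {H : Functionals D} (hH : A.map (mapCoeff (lb.flow H)) = ⁅P, A⁆) (hinv : IsUnit A) {L : ℤ}
    {C : MatPseudoDiffOp N D} (hC : IsRoot A L C) (n : ℤ) :
    integral D (lb.flow H (hamDensity L C n)) = 0 := by
  obtain ⟨u, rfl, hu⟩ := hC.exists_unit hinv
  rcases eq_or_ne n 0 with rfl | hn
  · rw [hamDensity_zero, map_zero, map_zero]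
  have hchain := pairing_zpow
    (isDerivationPairing_integral (D := D) (flow_mul lb H) (flow_D lb H)) u L n
  simp only [pairing_integral] at hchain
  rw [hu] at hchain
  let ρ : V →+ Functionals D := (integral D).toAddMonoidHom
  have hρ : ∀ a, ρ (D a) = 0 := integral_D D
  set G : MatPseudoDiffOp N D := ↑(u ^ (n - L)) with hG
  have hcomm : G * A = A * G := by
    rw [← hu, hG, ← Units.val_mul, ← Units.val_mul, ← zpow_add, ← zpow_add, add_comm]
  have hsum : ∑ i, ∑ j, integral D (mapCoeff (lb.flow H) (A i j) * G j i).residue = 0 := by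
    refine (residueTrace_mul ρ (A.map (mapCoeff (lb.flow H))) G).symm.trans ?_
    rw [hH, Ring.lie_def, sub_mul, map_sub, mul_assoc, mul_assoc, residueTrace_mul_comm ρ hρ A,
      mul_assoc, hcomm, sub_self]
  rw [hsum, integralPairing_apply, one_mul] at hchain
  have h := neg_div_smul_eq (F := F) hn hchain
  rw [hamDensity, if_neg hn, intPow_unit, map_smul, map_smul, h, neg_zero]

/-! ### Commutation of flows and the main theorem. -/

theorem coeff_zero_sum {E : Type*} [AddCommMonoid E] (p : V[X]) (f : ℕ → V → E)
    (h0 : f 0 0 = 0) (h : ∀ n x, n ≠ 0 → f n x = 0) : p.sum f = f 0 (p.coeff 0) := by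
  rw [Polynomial.sum_def]
  refine Finset.sum_eq_single 0 (fun n _ hn => h n _ hn) fun h => ?_
  rw [Polynomial.notMem_support_iff.1 h, h0]

/-- The Jacobi identity at `λ = μ = 0`. -/
theorem flow_jacobi {lb : LambdaBracket D} {W : Subalgebra F V} (hW : lb.IsPVASubalgebra W)
    {a b c : V} (ha : a ∈ W) (hb : b ∈ W) (hc : c ∈ W) :
    lb.flow (integral D a) (lb.flow (integral D b) c) -
      lb.flow (integral D b) (lb.flow (integral D a) c) =
    lb.flow (lb.funBracket (integral D a) (integral D b)) c := by
  let ev : V[X][X] →+* V := Polynomial.constantCoeff.comp Polynomial.constantCoeff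
  have hev : ∀ p, ev p = (p.coeff 0).coeff 0 := fun p => rfl
  have hsum : ∀ (p : V[X]) (f : ℕ → V → V[X][X]), ev (p.sum f) = p.sum fun n x => ev (f n x) :=
    fun p f => by rw [Polynomial.sum_def, Polynomial.sum_def, map_sum]
  have hX : ∀ n : ℕ, n ≠ 0 → ∀ r, ev (Polynomial.C (Polynomial.X ^ n) * r) = 0 := fun n hn r => by
    rw [map_mul, hev, Polynomial.coeff_C_zero, Polynomial.coeff_X_pow, if_neg (Ne.symm hn),
      zero_mul]
  -- `ev` sets `λ = μ = 0`: terms with a positive power of either variable vanish, and `λ + μ` in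
  -- the iterated bracket becomes `0`.
  have h := congrArg ev (hW.jacobi a ha b hb c hc)
  rw [map_sub, hsum, hsum, hsum, coeff_zero_sum, coeff_zero_sum, coeff_zero_sum] at h
  · rw [Polynomial.monomial_zero_left, pow_zero, Polynomial.C_1, one_mul, one_mul,
      Polynomial.hom_eval₂] at h
    have h1 : ev.comp (Polynomial.C.comp Polynomial.C) = RingHom.id V :=
      RingHom.ext fun x => by simp [ev]
    have h2 : ev (Polynomial.C Polynomial.X + Polynomial.X) = 0 := by simp [ev]
    rw [h1, h2, ← Polynomial.eval, ← Polynomial.coeff_zero_eq_eval_zero, hev, hev, Polynomial.coeff_C_zero,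
      Polynomial.coeff_map, Polynomial.coeff_C_zero] at h
    exact h
  · simp
  · exact fun n x hn => hX n hn _
  · simp
  · exact fun n x hn => hX n hn _
  · simp
  · intro n x hn
    simp [hev, Polynomial.coeff_monomial, hn]

end

end AdlerType

theorem theorem4p1 {F V : Type*} [Field F] [CharZero F] [CommRing V] [Algebra F V]
    (D : Derivation F V V) (lb : LambdaBracket D) (N : ℕ) (A : MatPseudoDiffOp N D)
    (hA : IsAdlerType lb A) (hinv : IsUnit A) :
    -- the functionals are pairwise in involution
    (∀ (K L : ℤ) (B C : MatPseudoDiffOp N D), IsRoot A K B → IsRoot A L C → ∀ m n : ℤ,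
      lb.funBracket (integral D (hamDensity K B m)) (integral D (hamDensity L C n)) = 0) ∧
    -- the Hamiltonian flows are the Lax equations
    (∀ (K : ℤ) (B : MatPseudoDiffOp N D), IsRoot A K B → ∀ n : ℤ,
      A.map (PseudoDiffOp.mapCoeff (lb.flow (integral D (hamDensity K B n)))) =
        ⁅(intPow B n).map PseudoDiffOp.posPart, A⁆) ∧
    -- the functionals are integrals of motion of all the flows
    (∀ (K L : ℤ) (B C : MatPseudoDiffOp N D), IsRoot A K B → IsRoot A L C → ∀ m n : ℤ,
      lb.IsIntegralOfMotion (integral D (hamDensity K B m)) (integral D (hamDensity L C n))) ∧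
    -- the flows commute on every Poisson vertex subalgebra containing the Hamiltonian densities
    (∀ W : Subalgebra F V, lb.IsPVASubalgebra W →
      ∀ (K L : ℤ) (B C : MatPseudoDiffOp N D), IsRoot A K B → IsRoot A L C → ∀ m n : ℤ,
        hamDensity K B m ∈ W → hamDensity L C n ∈ W → ∀ u ∈ W,
          lb.flow (integral D (hamDensity K B m)) (lb.flow (integral D (hamDensity L C n)) u) =
          lb.flow (integral D (hamDensity L C n)) (lb.flow (integral D (hamDensity K B m)) u)) := by
  have hinvol : ∀ (K L : ℤ) (B C : MatPseudoDiffOp N D), IsRoot A K B → IsRoot A L C →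
      ∀ m n : ℤ,
      lb.funBracket (integral D (hamDensity K B m)) (integral D (hamDensity L C n)) = 0 :=
    fun K L B C hB hC m n =>
      integral_flow_hamDensity (lax_equation hA hinv hB m) hinv hC n
  refine ⟨hinvol, fun K B hB n => lax_equation hA hinv hB n, ?_, ?_⟩
  · intro K L B C hB hC m n g hg
    have h := hinvol K L B C hB hC m n
    -- The bracket depends only on the class of the density, so the arbitrary representative `g` may
    -- replace `h_{n,C}`. The bracket is then definitionally the integral of the time derivative of
    -- `g`.
    rw [← hg] at h
    exact h
  · intro W hW K L B C hB hC m n hm hn u hu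
    rw [← sub_eq_zero, flow_jacobi hW hm hn hu, hinvol K L B C hB hC m n, map_zero,
      LinearMap.zero_apply]
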